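/- Definitions. For a set $A\subset\mathbb{R}^m$ let $\mathrm{Vol}_l(A)$ be its $l$-dimensional Euclidean volume (a point has $\mathrm{Vol}_0=1$), and let $\dim A$ be the dimension of its affine hull, with $\dim\emptyset=0$. Simplices are closed and nondegenerate, and a simplex is a face of itself. The fatness of a simplex $\tau$ is $$\varphi(\tau)=\min_{\sigma\le\tau}\frac{\mathrm{Vol}_{\dim\sigma}(\sigma)}{(\operatorname{diam}\sigma)^{\dim\sigma}}$$ (minimum over all nonempty faces $\sigma$ of $\tau$), and $\tau$ is $\varphi_0$-fat if $\varphi(\tau)\ge\varphi_0$. Let $\sigma_1,\sigma_2\subset\mathbb{R}^m$ be simplices of dimensions $k_1,k_2$ with $d_1=\operatorname{diam}\sigma_1\le\operatorname{diam}\sigma_2$. They are $\delta$-transverse if (i) $\dim(\sigma_1\cap\sigma_2)=\max(0,k_1+k_2-m)$; (ii) $0<\delta<\measuredangle(\sigma_1,\sigma_2)$, where $\measuredangle(\sigma_1,\sigma_2)$ is the smallest angle between nonzero vectors $v\in V_1$, $w\in V_2$ orthogonal to $V_1\cap V_2$, with $V_i$ the direction space of the affine hull of $\sigma_i$ (and $\pi/2$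 if there are no such vectors); (iii) $\operatorname{dist}(\sigma_3,\sigma_4)>\delta d_1$ for all faces $\sigma_3\le\sigma_1$, $\sigma_4\le\sigma_2$ with $\dim\sigma_3+\dim\sigma_4<m$. A cell is a nonempty intersection $\sigma_3\cap\sigma_4$ of a face $\sigma_3$ of $\sigma_1$ with a face $\sigma_4$ of $\sigma_2$. For a cell $\gamma_0$, $\partial\gamma_0$ is its relative boundary, and the distance to $\partial\gamma_0=\emptyset$ is $\infty$. Given a point $p_\beta\in\beta$ for each cell $\beta$, the barycentric subdivision of $\sigma_1\cap\sigma_2$ consists of the simplices with vertices $p_{\beta_0},\dots,p_{\beta_l}$ for the flags $\beta_0\subsetneq\dots\subsetneq\beta_l$ of cells; alternatively, the edges (one-dimensional cells) may be left undivided. **Proposition 3.2.** There are constants $\varphi_l$, depending only on $l$, such that for all $m$, $\varphi_0>0$ and $\delta>0$ there are constants $c>0$ and $c'>0$, depending only on $m,\varphi_0,\delta$, with the following property. Let $\sigma_1,\sigma_2\subset\mathbb{R}^m$ be $\varphi_0$-fat, $\delta$-transverse simplices (of any dimensions) with $d_1=\operatorname{diam}\sigma_1\le\operatorname{diam}\sigma_2$.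 Then: 1. If $\sigma_3\le\sigma_1$ and $\sigma_4\le\sigma_2$ are faces, $k_3=\dim\sigma_3$, $k_4=\dim\sigma_4$, and $\gamma_0=\sigma_3\cap\sigma_4\ne\emptyset$, then $k_3+k_4\ge m$, $\gamma_0$ is a closed convex polyhedral $(k_3+k_4-m)$-cell, and $$\mathrm{Vol}_{k_3+k_4-m}(\gamma_0)\ge c\,d_1^{\,k_3+k_4-m}.$$ 2. Each such $\gamma_0$ contains a point $p$ with $\operatorname{dist}(p,\partial\gamma_0)>c\,d_1$. 3. If all the points $p_\beta$ used in the barycentric subdivision of $\sigma_1\cap\sigma_2$ satisfy $p_\beta\in\beta$ and $\operatorname{dist}(p_\beta,\partial\beta)>c\,d_1$, with the $c$ of part 2, then each of its $l$-dimensional simplices $\tau$ is nondegenerate and satisfies $$\varphi_l\ \ge\ \frac{\mathrm{Vol}_l(\tau)}{d_1^{\,l}}\ \ge\ c',$$ and $\tau$ is $c'$-fat. -/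

import Mathlib

open MeasureTheory Affine

noncomputable section

namespace FatSimplices

/-- Euclidean `n`-space. -/
abbrev E (n : ℕ) : Type := EuclideanSpace ℝ (Fin n)

/-- The `l`-dimensional Euclidean volume of a subset of `ℝⁿ`: the `l`-dimensional Hausdorff measure,
normalized so as to agree with Lebesgue measure on `ℝˡ` (the counting measure if `l = 0`, so that a
point has volume `1`). -/
def vol {n : ℕ} (l : ℕ) (A : Set (E n)) : ℝ := (μHE[l] A).toReal

/-- The dimension of (the affine hull of) a subset of `ℝⁿ`; the empty set gets dimension `0`. -/
def dim {n : ℕ} (A : Set (E n)) : ℕ := Module.finrank ℝ (vectorSpan ℝ A)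

/-- The fatness of a `k`-simplex `τ`: the infimum (a minimum over finitely many faces) of
`Vol(σ) / (diam σ) ^ l`, over all the faces `σ` of `τ`, where `l = dim σ`. The faces are the convex
hulls of the nonempty sets of vertices; `τ` itself and the vertices of `τ` are among them. -/
def fatness {n k : ℕ} (τ : Simplex ℝ (E n) k) : ℝ :=
  ⨅ f : {f : Finset (Fin (k + 1)) // f.Nonempty},
    vol (f.1.card - 1) (convexHull ℝ (τ.points '' f.1)) /
      Metric.diam (convexHull ℝ (τ.points '' f.1)) ^ (f.1.card - 1)

/-- `τ` is `φ₀`-fat. -/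
def IsFat {n k : ℕ} (φ₀ : ℝ) (τ : Simplex ℝ (E n) k) : Prop := φ₀ ≤ fatness τ

/-- The angle between two linear subspaces `V`, `W`: the smallest angle between nonzero vectors
`v ∈ V`, `w ∈ W` orthogonal to `V ⊓ W`, and `π / 2` if there are no such vectors (one of the
subspaces contains the other). Since `w` may be replaced by `-w`, the smallest angle is at most
`π / 2` as soon as there are such vectors, so inserting `π / 2` only settles the latter case. -/
def subspaceAngle {n : ℕ} (V W : Submodule ℝ (E n)) : ℝ :=
  sInf (insert (Real.pi / 2) {θ | ∃ v ∈ V ⊓ (V ⊓ W)ᗮ, ∃ w ∈ W ⊓ (V ⊓ W)ᗮ,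
    v ≠ 0 ∧ w ≠ 0 ∧ θ = InnerProductGeometry.angle v w})

/-- The angle between two simplices: the angle between the directions of their affine hulls. -/
def simplexAngle {n k₁ k₂ : ℕ} (σ₁ : Simplex ℝ (E n) k₁) (σ₂ : Simplex ℝ (E n) k₂) : ℝ :=
  subspaceAngle (vectorSpan ℝ (Set.range σ₁.points)) (vectorSpan ℝ (Set.range σ₂.points))

/-- The distance `inf {dist a b | a ∈ A, b ∈ B}` between two sets, with values in `[0, ∞]`. -/
def setDist {n : ℕ} (A B : Set (E n)) : ENNReal := ⨅ a ∈ A, Metric.infEDist a B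

/-- `σ₁` and `σ₂` are `δ`-transverse in `ℝⁿ`; used for `diam σ₁ ≤ diam σ₂`. -/
structure IsTransverse {n k₁ k₂ : ℕ} (δ : ℝ) (σ₁ : Simplex ℝ (E n) k₁)
    (σ₂ : Simplex ℝ (E n) k₂) : Prop where
  dim_inter :
    (dim (σ₁.closedInterior ∩ σ₂.closedInterior) : ℤ) = max 0 ((k₁ : ℤ) + (k₂ : ℤ) - (n : ℤ))
  pos : 0 < δ
  lt_angle : δ < simplexAngle σ₁ σ₂
  lt_dist : ∀ (k₃ k₄ : ℕ) (f₃ : Finset (Fin (k₁ + 1))) (f₄ : Finset (Fin (k₂ + 1)))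
    (h₃ : f₃.card = k₃ + 1) (h₄ : f₄.card = k₄ + 1), k₃ + k₄ < n →
    ENNReal.ofReal (δ * Metric.diam σ₁.closedInterior) <
      setDist (σ₁.face h₃).closedInterior (σ₂.face h₄).closedInterior

/-- A closed convex polyhedral `q`-cell: a nonempty bounded intersection of finitely many closed
half-spaces whose affine hull has dimension `q`. -/
structure IsConvexCell {n : ℕ} (q : ℕ) (γ : Set (E n)) : Prop where
  nonempty : γ.Nonempty
  bounded : Bornology.IsBounded γ
  polyhedral : ∃ H : Finset ((E n →L[ℝ] ℝ) × ℝ), γ = {x | ∀ h ∈ H, h.1 x ≤ h.2}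
  dim_eq : dim γ = q

/-- The cells of `σ₁ ∩ σ₂`: the nonempty intersections of a (closed) face of `σ₁` with a (closed)
face of `σ₂`. -/
def cells {n k₁ k₂ : ℕ} (σ₁ : Simplex ℝ (E n) k₁) (σ₂ : Simplex ℝ (E n) k₂) : Set (Set (E n)) :=
  {β | β.Nonempty ∧ ∃ (k₃ k₄ : ℕ) (f₃ : Finset (Fin (k₁ + 1))) (f₄ : Finset (Fin (k₂ + 1)))
    (h₃ : f₃.card = k₃ + 1) (h₄ : f₄.card = k₄ + 1),
    β = (σ₁.face h₃).closedInterior ∩ (σ₂.face h₄).closedInterior}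

/-- The point `x` lies deep in the cell `γ`: `x ∈ γ` and `dist(x, ∂γ) > r`, where `∂γ` is the
relative boundary of `γ`. (If `γ` is a point then `∂γ = ∅`, and the distance is `∞`.) -/
def IsDeepPoint {n : ℕ} (r : ℝ) (γ : Set (E n)) (x : E n) : Prop :=
  x ∈ γ ∧ ENNReal.ofReal r < Metric.infEDist x (intrinsicFrontier ℝ γ)

/-- `q 0, …, q l` are the vertices of a simplex of the barycentric subdivision of the cell
`σ₁ ∩ σ₂` with apices `p β`. Unfolding the inductive construction (join `p β` to the simplices into
which `∂β` has been divided), these are the simplices that belong to the flags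
`β 0 ⊂ β 1 ⊂ ⋯ ⊂ β l` of cells: `q i` is the apex of `β i`.

The cells of dimension at least `r` are divided by joins with their apices; the cells of smaller
dimension are left as they are, and there `q i` is a vertex of `β i` outside the smaller cells of
the flag. For `r = 1` this is the full barycentric subdivision (a `0`-cell is its only vertex), and
for `r = 2` the variant in which edges, being simplices already, are not divided. -/
def IsBarycentricSimplex {n k₁ k₂ : ℕ} (σ₁ : Simplex ℝ (E n) k₁) (σ₂ : Simplex ℝ (E n) k₂)
    (r : ℕ) (p : Set (E n) → E n) {l : ℕ} (q : Fin (l + 1) → E n) : Prop :=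
  ∃ β : Fin (l + 1) → Set (E n), StrictMono β ∧ (∀ i, β i ∈ cells σ₁ σ₂) ∧
    ∀ i, (r ≤ dim (β i) ∧ q i = p (β i)) ∨
      (dim (β i) < r ∧ q i ∈ β i ∧ {q i} ∈ cells σ₁ σ₂ ∧ ∀ j < i, q i ∉ β j)

end FatSimplices

end

open FatSimplices

/-!
# Fat transverse simplices

Fatness only enters through the heights of a simplex: a simplex lies in a slab as thick as any of
its heights, so a large volume forces all heights to be comparable to the diameter
(`IsFat.isSpread`); equivalently, the barycentric coordinates are Lipschitz at that scale. The
property `IsSpread` expresses this by a lower bound for the affine relations between the vertices;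
conversely, spread vertices give a simplex that contains a large ball about its barycenter
(`IsSpread.le_vol`), and so do those of its faces, hence it is fat (`IsSpread.isFat`).

Transversality only enters through the distances between faces of small dimension. Consider a
nonempty cell, the intersection of a face of `σ₁` with a face of `σ₂`, and an extreme point of it.
The faces that carry this point have directions with trivial intersection, so that their dimensions
add up to at most `m`, and to exactly `m` since faces of smaller dimensions are disjoint
(`complementary_of_extreme`). Dropping a vertex of a carrying face leaves dimensions that add up to
less than `m`, and so the extreme point has distance more than `δ * d₁` from the opposite facet: its
nonzero barycentric coordinates are bounded below (`lt_weight_mul_of_extreme`). On the other hand,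
every vertex of the two faces has a nonzero coordinate at some extreme point of the cell, since the
directions of the carrying faces span `ℝᵐ` (`exists_extreme_pos`). An average of extreme points
therefore has all its coordinates bounded below, and, the coordinates being Lipschitz, it is the
center of a ball of radius comparable to `d₁` in the intersection of the affine hulls that is
contained in the cell (`exists_center`). This yields the dimension of the cell, the bound for its
volume, and a deep point (`cell_geometry`).

In a flag of cells, each apex is far from the affine hull of the preceding cell. For a deep point,
a barycentric coordinate that vanishes on the smaller cell is nonnegative, but not identically zero,
on the ball about the point, so that the affine hull misses the ball (`IsDeepPoint.le_dist`); for a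
vertex of the intersection the lower bound for its coordinates serves (`IsSpread.le_dist`). By
induction along the flag the vertices of the simplices of the subdivision are spread
(`isSpread_of_le_dist`, `flag_isSpread`), which gives their fatness and volume.

If `d₁ = 0`, then `σ₁` is a point, the only cell, and the claims are checked directly.
-/

noncomputable section

namespace FatSimplices

/-! ### Barycentric weights -/

/-- `w` is a system of barycentric weights carried by the set `f` of vertices: the weights are
nonnegative, vanish off `f` and add up to `1`. -/
structure IsWeight {ι : Type*} [Fintype ι] (f : Finset ι) (w : ι → ℝ) : Prop where
  nonneg : ∀ i, 0 ≤ w i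
  eq_zero : ∀ i ∉ f, w i = 0
  sum_eq : ∑ i, w i = 1

section Weights

variable {ι V : Type*} [Fintype ι]

theorem IsWeight.mono {f g : Finset ι} {w : ι → ℝ} (hw : IsWeight f w) (hfg : f ⊆ g) :
    IsWeight g w :=
  ⟨hw.nonneg, fun i hi => hw.eq_zero i fun h => hi (hfg h), hw.sum_eq⟩

theorem IsWeight.le_one {f : Finset ι} {w : ι → ℝ} (hw : IsWeight f w) (i : ι) : w i ≤ 1 := by
  rw [← hw.sum_eq]
  exact Finset.single_le_sum (fun j _ => hw.nonneg j) (Finset.mem_univ i)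

theorem IsWeight.nonempty {f : Finset ι} {w : ι → ℝ} (hw : IsWeight f w) : f.Nonempty := by
  by_contra h
  rw [Finset.not_nonempty_iff_eq_empty] at h
  have := hw.sum_eq
  rw [Finset.sum_eq_zero fun i _ => hw.eq_zero i (by simp [h])] at this
  exact zero_ne_one this

/-- The support of a weight, that is, the set of vertices of the smallest face on which it lives. -/
def support (w : ι → ℝ) : Finset ι := Finset.univ.filter fun i => w i ≠ 0

@[simp] theorem mem_support {w : ι → ℝ} {i : ι} : i ∈ support w ↔ w i ≠ 0 := by
  simp [support]

theorem IsWeight.to_support {f : Finset ι} {w : ι → ℝ} (hw : IsWeight f w) :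
    IsWeight (support w) w :=
  ⟨hw.nonneg, fun i hi => by simpa using hi, hw.sum_eq⟩

theorem IsWeight.support_subset {f : Finset ι} {w : ι → ℝ} (hw : IsWeight f w) :
    support w ⊆ f := fun i hi => by
  by_contra h
  exact mem_support.1 hi (hw.eq_zero i h)

variable [NormedAddCommGroup V] [NormedSpace ℝ V]

theorem mem_convexHull_image {P : ι → V} {f : Finset ι} {x : V} :
    x ∈ convexHull ℝ (P '' f) ↔ ∃ w, IsWeight f w ∧ ∑ i, w i • P i = x := by
  classical
  constructor
  · intro hx
    have hconv : Convex ℝ {x : V | ∃ w, IsWeight f w ∧ ∑ i, w i • P i = x} := by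
      rintro _ ⟨w, hw, rfl⟩ _ ⟨z, hz, rfl⟩ a b ha hb hab
      refine ⟨fun i => a * w i + b * z i, ⟨fun i => ?_, fun i hi => ?_, ?_⟩, ?_⟩
      · exact add_nonneg (mul_nonneg ha (hw.nonneg i)) (mul_nonneg hb (hz.nonneg i))
      · simp [hw.eq_zero i hi, hz.eq_zero i hi]
      · rw [Finset.sum_add_distrib, ← Finset.mul_sum, ← Finset.mul_sum, hw.sum_eq, hz.sum_eq]
        linarith
      · simp only [add_smul, mul_smul, Finset.sum_add_distrib, Finset.smul_sum]
    refine convexHull_min ?_ hconv hx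
    rintro _ ⟨i, hi, rfl⟩
    refine ⟨Pi.single i 1, ⟨fun j => ?_, fun j hj => ?_, ?_⟩, ?_⟩
    · by_cases h : j = i
      · subst h; simp
      · simp [h]
    · have : j ≠ i := fun h => hj (h ▸ hi)
      simp [this]
    · simp
    · rw [Finset.sum_eq_single i (fun j _ hj => by simp [hj]) (by simp)]
      simp
  · rintro ⟨w, hw, rfl⟩
    have hs : ∑ i ∈ f, w i • P i = ∑ i, w i • P i :=
      Finset.sum_subset (Finset.subset_univ f) fun i _ hi => by simp [hw.eq_zero i hi]
    have hs' : ∑ i ∈ f, w i = 1 := by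
      rw [← hw.sum_eq]
      exact Finset.sum_subset (Finset.subset_univ f) fun i _ hi => hw.eq_zero i hi
    rw [← hs]
    exact (convex_convexHull ℝ _).sum_mem (fun i _ => hw.nonneg i) hs' fun i hi =>
      subset_convexHull ℝ _ ⟨i, hi, rfl⟩

theorem mem_vectorSpan_image {P : ι → V} {f : Finset ι} {u : V} :
    u ∈ vectorSpan ℝ (P '' f) ↔
      ∃ t : ι → ℝ, (∀ i ∉ f, t i = 0) ∧ ∑ i, t i = 0 ∧ ∑ i, t i • P i = u := by
  classical
  constructor
  · intro hu
    rw [vectorSpan_def] at hu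
    induction hu using Submodule.span_induction with
    | mem x hx =>
      obtain ⟨_, ⟨i, hi, rfl⟩, _, ⟨j, hj, rfl⟩, rfl⟩ := hx
      refine ⟨Pi.single i 1 - Pi.single j 1, fun k hk => ?_, ?_, ?_⟩
      · have h1 : k ≠ i := fun h => hk (h ▸ hi)
        have h2 : k ≠ j := fun h => hk (h ▸ hj)
        simp [h1, h2]
      · simp
      · simp [sub_smul, Pi.single_apply, Finset.sum_sub_distrib, ite_smul]
    | zero => exact ⟨0, by simp, by simp, by simp⟩
    | add x y _ _ hx hy =>
      obtain ⟨t, h1, h2, rfl⟩ := hx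
      obtain ⟨t', h1', h2', rfl⟩ := hy
      exact ⟨t + t', fun i hi => by simp [h1 i hi, h1' i hi],
        by simp [Finset.sum_add_distrib, h2, h2'], by simp [add_smul, Finset.sum_add_distrib]⟩
    | smul a x _ hx =>
      obtain ⟨t, h1, h2, rfl⟩ := hx
      exact ⟨a • t, fun i hi => by simp [h1 i hi], by simp [← Finset.mul_sum, h2],
        by simp [Finset.smul_sum, mul_smul]⟩
  · rintro ⟨t, h1, h2, rfl⟩
    rcases f.eq_empty_or_nonempty with rfl | ⟨i₀, hi₀⟩
    · simp [fun i => h1 i (by simp)]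
    · have : ∑ i, t i • P i = ∑ i, t i • (P i - P i₀) := by
        simp [smul_sub, Finset.sum_sub_distrib, ← Finset.sum_smul, h2]
      rw [this]
      refine Submodule.sum_mem _ fun i _ => ?_
      by_cases hi : i ∈ f
      · exact Submodule.smul_mem _ _ (vsub_mem_vectorSpan ℝ ⟨i, hi, rfl⟩ ⟨i₀, hi₀, rfl⟩)
      · simp [h1 i hi]

theorem IsWeight.add {f : Finset ι} {w t : ι → ℝ} (hw : IsWeight f w)
    (ht : ∀ i ∉ f, t i = 0) (hs : ∑ i, t i = 0) (hle : ∀ i ∈ f, -t i ≤ w i) :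
    IsWeight f (w + t) := by
  refine ⟨fun i => ?_, fun i hi => by simp [hw.eq_zero i hi, ht i hi], by
    simp [Finset.sum_add_distrib, hw.sum_eq, hs]⟩
  by_cases hi : i ∈ f
  · have := hle i hi
    simp only [Pi.add_apply]
    linarith
  · simp [hw.eq_zero i hi, ht i hi]

/-- The vertices `P i` are spread out at scale `s`: every affine relation `t` satisfies
`s * |t j| ≤ ‖∑ i, t i • P i‖`. Equivalently, each barycentric coordinate is a `1 / s`-Lipschitz
function on the affine hull, or all heights of the simplex are at least `s`. -/
def IsSpread (s : ℝ) (P : ι → V) : Prop :=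
  ∀ t : ι → ℝ, ∑ i, t i = 0 → ∀ j, s * |t j| ≤ ‖∑ i, t i • P i‖

theorem IsSpread.affineIndependent {s : ℝ} (hs : 0 < s) {P : ι → V} (hP : IsSpread s P) :
    AffineIndependent ℝ P := by
  classical
  rw [affineIndependent_iff]
  intro e t h0 h1 i hi
  have key := hP (fun i => if i ∈ e then t i else 0) (by simpa using h0) i
  have : ∑ i, (if i ∈ e then t i else 0) • P i = 0 := by
    rw [← h1]; simp [ite_smul]
  rw [this, norm_zero] at key
  simp only [hi, if_true] at key
  exact abs_eq_zero.1 (le_antisymm (by nlinarith [abs_nonneg (t i)]) (abs_nonneg _))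

/-- Barycentric coordinates with respect to spread vertices are Lipschitz. -/
theorem IsSpread.abs_sub_le {s : ℝ} {P : ι → V} (hP : IsSpread s P) {w z : ι → ℝ}
    (hw : ∑ i, w i = 1) (hz : ∑ i, z i = 1) (j : ι) :
    s * |w j - z j| ≤ ‖∑ i, w i • P i - ∑ i, z i • P i‖ := by
  have := hP (w - z) (by simp [hw, hz]) j
  simpa [sub_smul] using this

theorem weights_unique {P : ι → V} (hP : AffineIndependent ℝ P) {w z : ι → ℝ}
    (hw : ∑ i, w i = 1) (hz : ∑ i, z i = 1) (h : ∑ i, w i • P i = ∑ i, z i • P i) : w = z := by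
  rw [affineIndependent_iff] at hP
  ext i
  have := hP Finset.univ (w - z) (by simp [hw, hz]) (by simp [sub_smul, h]) i (Finset.mem_univ i)
  simpa [sub_eq_zero] using this

end Weights

section

/-! ### Volumes in affine subspaces -/

/-- The volume of the unit ball of Euclidean `l`-space. -/
def ballVol (l : ℕ) : ℝ := (volume (Metric.ball (0 : E l) 1)).toReal

theorem ballVol_pos (l : ℕ) : 0 < ballVol l :=
  ENNReal.toReal_pos (Metric.measure_ball_pos volume _ one_pos).ne' measure_ball_lt_top.ne

theorem volume_ball_toReal (l : ℕ) {ρ : ℝ} (hρ : 0 < ρ) :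
    (volume (Metric.ball (0 : E l) ρ)).toReal = ρ ^ l * ballVol l := by
  rw [Measure.addHaar_ball_of_pos volume _ hρ, ENNReal.toReal_mul, ballVol,
    ENNReal.toReal_ofReal (by positivity)]
  simp

theorem volume_closedBall_toReal (l : ℕ) {ρ : ℝ} (hρ : 0 ≤ ρ) :
    (volume (Metric.closedBall (0 : E l) ρ)).toReal = ρ ^ l * ballVol l := by
  rw [Measure.addHaar_closedBall volume _ hρ, ENNReal.toReal_mul, ballVol,
    ENNReal.toReal_ofReal (by positivity)]
  simp

variable {m : ℕ}

/-- The isometric parametrization of the affine subspace `p + W` by Euclidean space that an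
orthonormal basis of `W` provides. -/
def param {W : Submodule ℝ (E m)} {l : ℕ} (b : OrthonormalBasis (Fin l) ℝ W) (p : E m) (y : E l) :
    E m :=
  p + (b.repr.symm y : E m)

theorem isometry_param {W : Submodule ℝ (E m)} {l : ℕ} (b : OrthonormalBasis (Fin l) ℝ W)
    (p : E m) : Isometry (param b p) := by
  refine Isometry.of_dist_eq fun x y => ?_
  simp only [param, dist_add_left]
  rw [← Subtype.dist_eq, LinearIsometryEquiv.dist_map]

theorem dist_param {W : Submodule ℝ (E m)} {l : ℕ} (b : OrthonormalBasis (Fin l) ℝ W)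
    (p : E m) (y : E l) : dist (param b p y) p = dist y 0 := by
  rw [param, dist_self_add_left, ← Submodule.coe_norm, LinearIsometryEquiv.norm_map,
    dist_zero_right]

theorem exists_param_eq {W : Submodule ℝ (E m)} {l : ℕ} (b : OrthonormalBasis (Fin l) ℝ W)
    {p x : E m} (hx : x - p ∈ W) : ∃ y, param b p y = x :=
  ⟨b.repr ⟨x - p, hx⟩, by simp [param]⟩

theorem vol_eq {W : Submodule ℝ (E m)} {l : ℕ} (b : OrthonormalBasis (Fin l) ℝ W)
    {p : E m} {A : Set (E m)} (hA : ∀ x ∈ A, x - p ∈ W) :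
    vol l A = (volume (param b p ⁻¹' A)).toReal := by
  have : A = param b p '' (param b p ⁻¹' A) := by
    rw [Set.image_preimage_eq_of_subset]
    exact fun x hx => exists_param_eq b (hA x hx)
  rw [vol]
  conv_lhs => rw [this]
  rw [(isometry_param b p).euclideanHausdorffMeasure_image,
    EuclideanSpace.euclideanHausdorffMeasure_eq_volume]

/-- A bounded subset of an `l`-dimensional affine subspace that contains a ball of the subspace has
at least the volume of that ball. -/
theorem le_vol {W : Submodule ℝ (E m)} {l : ℕ} (hl : Module.finrank ℝ W = l)
    {p : E m} {A : Set (E m)} (hA : ∀ x ∈ A, x - p ∈ W) (hb : Bornology.IsBounded A) {ρ : ℝ}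
    (hρ : 0 < ρ) (hball : ∀ u ∈ W, ‖u‖ < ρ → p + u ∈ A) : ρ ^ l * ballVol l ≤ vol l A := by
  subst hl
  set b := stdOrthonormalBasis ℝ W
  rw [vol_eq b hA, ← volume_ball_toReal _ hρ]
  refine ENNReal.toReal_mono ?_ (measure_mono fun y hy => ?_)
  · have : Bornology.IsBounded (param b p ⁻¹' A) := by
      obtain ⟨r, hr⟩ := hb.subset_closedBall p
      refine (Metric.isBounded_closedBall (x := (0 : E _)) (r := r)).subset fun y hy => ?_
      have := hr hy
      rwa [Metric.mem_closedBall, dist_param] at this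
    exact this.measure_lt_top.ne
  · refine hball _ (b.repr.symm y).2 ?_
    rw [mem_ball_zero_iff] at hy
    rwa [← Submodule.coe_norm, LinearIsometryEquiv.norm_map]

theorem vol_le {W : Submodule ℝ (E m)} {l : ℕ} (hl : Module.finrank ℝ W = l)
    {p : E m} {A : Set (E m)} (hA : ∀ x ∈ A, x - p ∈ W) {ρ : ℝ} (hρ : 0 ≤ ρ)
    (hball : ∀ x ∈ A, dist x p ≤ ρ) : vol l A ≤ ρ ^ l * ballVol l := by
  subst hl
  set b := stdOrthonormalBasis ℝ W
  rw [vol_eq b hA, ← volume_closedBall_toReal _ hρ]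
  refine ENNReal.toReal_mono measure_closedBall_lt_top.ne (measure_mono fun y hy => ?_)
  have := hball _ hy
  rwa [dist_param] at this

/-- Volume bound for a set that lies in the ball of radius `d` about `p` and in the slab of
thickness `2 * h` normal to `n`: enclose it in a box. -/
theorem vol_le_of_slab {W : Submodule ℝ (E m)} {l : ℕ} (hl : Module.finrank ℝ W = l + 1)
    {p : E m} {A : Set (E m)} (hA : ∀ x ∈ A, x - p ∈ W) {d h : ℝ} (hd : 0 ≤ d) (hh : 0 ≤ h)
    {n : E m} (hn : n ∈ W) (hn1 : ‖n‖ = 1) (hball : ∀ x ∈ A, dist x p ≤ d)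
    (hslab : ∀ x ∈ A, |inner ℝ n (x - p)| ≤ h) :
    vol (l + 1) A ≤ (2 * h) * (2 * d) ^ l := by
  -- an orthonormal basis of `W` with first vector `n`
  have hv : Orthonormal ℝ (Set.domRestrict {(0 : Fin (l + 1))}
      (fun _ : Fin (l + 1) => (⟨n, hn⟩ : W))) := by
    refine ⟨fun _ => hn1, fun i j hij => ?_⟩
    exact absurd (Subsingleton.elim i j) hij
  obtain ⟨b, hb⟩ := hv.exists_orthonormalBasis_extension_of_card_eq (by simp [hl])
  have hb0 : b 0 = ⟨n, hn⟩ := hb 0 rfl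
  rw [vol_eq b hA]
  let lo : Fin (l + 1) → ℝ := Fin.cons (-h) fun _ => -d
  let hi : Fin (l + 1) → ℝ := Fin.cons h fun _ => d
  have hsub : param b p ⁻¹' A ⊆
      (MeasurableEquiv.toLp 2 (Fin (l + 1) → ℝ)).symm ⁻¹' Set.Icc lo hi := by
    intro y hy
    have hcoord : ∀ i, |y i| ≤ (Fin.cons h fun _ => d : Fin (l + 1) → ℝ) i := by
      intro i
      refine Fin.cases ?_ (fun j => ?_) i
      · have := hslab _ hy
        simp only [param, add_sub_cancel_left] at this
        have h2 : inner ℝ (b 0) (b.repr.symm y) = y 0 := by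
          rw [← b.repr_apply_apply]; simp
        rw [hb0] at h2
        rw [Submodule.coe_inner] at h2
        simpa [h2] using this
      · have := hball _ hy
        rw [dist_param, dist_zero_right] at this
        simpa using (PiLp.norm_apply_le y j.succ).trans this
    have hlo : lo = -hi := by
      ext i
      refine Fin.cases ?_ (fun j => ?_) i <;> simp [lo, hi]
    refine ⟨fun i => ?_, fun i => (abs_le.1 (hcoord i)).2⟩
    rw [hlo]
    exact (abs_le.1 (hcoord i)).1
  have hvol : volume ((MeasurableEquiv.toLp 2 (Fin (l + 1) → ℝ)).symm ⁻¹' Set.Icc lo hi) =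
      ENNReal.ofReal ((2 * h) * (2 * d) ^ l) := by
    rw [(EuclideanSpace.volume_preserving_symm_measurableEquiv_toLp (Fin (l + 1))).measure_preimage
      measurableSet_Icc.nullMeasurableSet, Real.volume_Icc_pi, ← ENNReal.ofReal_prod_of_nonneg]
    · congr 1
      rw [Fin.prod_univ_succ]
      simp only [lo, hi, Fin.cons_zero, Fin.cons_succ, Finset.prod_const, Finset.card_univ,
        Fintype.card_fin]
      ring
    · intro i _
      refine Fin.cases ?_ (fun j => ?_) i <;> simp [lo, hi] <;> linarith
  rw [← ENNReal.toReal_ofReal (show 0 ≤ (2 * h) * (2 * d) ^ l by positivity), ← hvol]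
  exact ENNReal.toReal_mono (by rw [hvol]; exact ENNReal.ofReal_ne_top) (measure_mono hsub)

theorem vol_zero_singleton (x : E m) : vol 0 {x} = 1 := by
  simp [vol]

end

section

/-! ### Fatness and the spread of the vertices -/

variable {m : ℕ}

theorem closedInterior_eq {k : ℕ} (σ : Simplex ℝ (E m) k) :
    σ.closedInterior = convexHull ℝ (σ.points '' (Finset.univ : Finset (Fin (k + 1)))) := by
  rw [← Simplex.convexHull_eq_closedInterior, Finset.coe_univ, Set.image_univ]

theorem closedInterior_face_eq {k j : ℕ} (σ : Simplex ℝ (E m) k) {f : Finset (Fin (k + 1))}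
    (hf : f.card = j + 1) :
    (σ.face hf).closedInterior = convexHull ℝ (σ.points '' f) := by
  rw [← Simplex.convexHull_eq_closedInterior, Simplex.range_face_points]

theorem isBounded_hull {ι : Type*} (P : ι → E m) (f : Finset ι) :
    Bornology.IsBounded (convexHull ℝ (P '' f)) :=
  ((f.finite_toSet.image P).isCompact_convexHull ℝ).isBounded

theorem sub_mem_of_mem_hull {ι : Type*} {P : ι → E m} {f : Finset ι} {x y : E m}
    (hx : x ∈ convexHull ℝ (P '' f)) (hy : y ∈ convexHull ℝ (P '' f)) :
    x - y ∈ vectorSpan ℝ (P '' f) := by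
  rw [← direction_affineSpan]
  exact AffineSubspace.vsub_mem_direction (convexHull_subset_affineSpan _ hx)
    (convexHull_subset_affineSpan _ hy)

theorem dist_points_le {k : ℕ} (σ : Simplex ℝ (E m) k) (i j : Fin (k + 1)) :
    dist (σ.points i) (σ.points j) ≤ Metric.diam σ.closedInterior :=
  Metric.dist_le_diam_of_mem σ.isCompact_closedInterior.isBounded
    (σ.point_mem_closedInterior i) (σ.point_mem_closedInterior j)

theorem finrank_vectorSpan_image {ι : Type*} {P : ι → E m} (hP : AffineIndependent ℝ P)
    {f : Finset ι} (hf : f.Nonempty) :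
    Module.finrank ℝ (vectorSpan ℝ (P '' f)) + 1 = f.card := by
  classical
  have := hP.finrank_vectorSpan_image_finset (s := f) (n := f.card - 1)
    (Nat.succ_pred_eq_of_pos hf.card_pos).symm
  rw [Finset.coe_image] at this
  have h := hf.card_pos
  omega

theorem le_of_affineIndependent {k : ℕ} {P : Fin (k + 1) → E m} (hP : AffineIndependent ℝ P) :
    k ≤ m := by
  have h1 := finrank_vectorSpan_image hP (f := Finset.univ) Finset.univ_nonempty
  have h2 := Submodule.finrank_le (vectorSpan ℝ (P '' (Finset.univ : Finset (Fin (k + 1)))))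
  simp only [finrank_euclideanSpace, Fintype.card_fin, Finset.card_univ] at h1 h2
  omega

/-- The volume of a simplex is at most that of a slab containing it, so a fat simplex has heights
proportional to its diameter. -/
theorem IsFat.isSpread {k : ℕ} {σ : Simplex ℝ (E m) k} {φ₀ : ℝ} (hφ : 0 < φ₀)
    (hσ : IsFat φ₀ σ) : IsSpread (φ₀ / 2 ^ m * Metric.diam σ.closedInterior) σ.points := by
  set d := Metric.diam σ.closedInterior with hd
  have hd0 : 0 ≤ d := Metric.diam_nonneg
  intro t ht j
  rcases k with _ | l
  · have : t j = 0 := by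
      rw [← ht, Fintype.sum_eq_single j fun i hi => absurd (Subsingleton.elim (α := Fin 1) i j) hi]
    simp [this]
  have hvol : φ₀ * d ^ (l + 1) ≤ vol (l + 1) σ.closedInterior := by
    have h1 : φ₀ ≤ _ := hσ
    have h2 := h1.trans (ciInf_le (Set.finite_range _).bddBelow
      ⟨(Finset.univ : Finset (Fin (l + 1 + 1))), Finset.univ_nonempty⟩)
    simp only [Finset.card_univ, Fintype.card_fin, add_tsub_cancel_right] at h2
    rw [← closedInterior_eq, ← hd] at h2
    rcases (pow_nonneg hd0 (l + 1)).eq_or_lt with h0 | h0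
    · rw [← h0, div_zero] at h2
      exact absurd h2 (not_le.2 hφ)
    · exact (le_div_iff₀ h0).1 h2
  rcases hd0.eq_or_lt with h0 | hdpos
  · rw [← h0]; simp
  -- a unit normal `n` of the facet opposite to the vertex `j`
  set f : Finset (Fin (l + 1 + 1)) := Finset.univ.erase j with hf
  obtain ⟨i₀, hi₀⟩ : ∃ i₀, i₀ ≠ j := exists_ne j
  have hi₀f : i₀ ∈ f := by simp [hf, hi₀]
  set W := vectorSpan ℝ (σ.points '' (Finset.univ : Finset (Fin (l + 1 + 1)))) with hW
  set W' := vectorSpan ℝ (σ.points '' f) with hW'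
  have hle : W' ≤ W := vectorSpan_mono ℝ (Set.image_mono (by simp))
  have hrW : Module.finrank ℝ W = l + 1 := by
    have := finrank_vectorSpan_image σ.independent (f := Finset.univ) Finset.univ_nonempty
    simpa using this
  have hrW' : Module.finrank ℝ W' = l := by
    have := finrank_vectorSpan_image σ.independent (f := f) ⟨i₀, hi₀f⟩
    simpa [hf] using this
  obtain ⟨v, hvW, hvne, hvort⟩ : ∃ v ∈ W, v ≠ 0 ∧ v ∈ W'ᗮ := by
    have h1 : W' < W := lt_of_le_of_ne hle fun h => by rw [h, hrW] at hrW'; omega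
    have h2 : W'ᗮ ⊓ W ≠ ⊥ := fun h => h1.ne <| by
      have := Submodule.sup_orthogonal_inf_of_hasOrthogonalProjection hle
      rwa [h, sup_bot_eq] at this
    obtain ⟨v, hv, hne⟩ := Submodule.exists_mem_ne_zero_of_ne_bot h2
    exact ⟨v, hv.2, hne, hv.1⟩
  set n : E m := ‖v‖⁻¹ • v with hn
  have hnW : n ∈ W := W.smul_mem _ hvW
  have hn1 : ‖n‖ = 1 := by
    rw [hn, norm_smul, norm_inv, norm_norm, inv_mul_cancel₀ (norm_ne_zero_iff.2 hvne)]
  have hnort : ∀ i, i ≠ j → inner ℝ n (σ.points i - σ.points i₀) = 0 := fun i hi => by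
    refine (Submodule.mem_orthogonal' _ _).1 (W'ᗮ.smul_mem _ hvort) _ ?_
    exact vsub_mem_vectorSpan ℝ ⟨i, by simp [hf, hi], rfl⟩ ⟨i₀, hi₀f, rfl⟩
  set h := |inner ℝ n (σ.points j - σ.points i₀)| with hh
  have hcomb : ∀ w : Fin (l + 1 + 1) → ℝ,
      inner ℝ n (∑ i, w i • (σ.points i - σ.points i₀)) =
        w j * inner ℝ n (σ.points j - σ.points i₀) := by
    intro w
    rw [inner_sum, Finset.sum_eq_single j]
    · rw [inner_smul_right]
    · intro i _ hi
      rw [inner_smul_right, hnort i hi, mul_zero]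
    · simp
  have hslab : vol (l + 1) σ.closedInterior ≤ (2 * h) * (2 * d) ^ l := by
    have hi₀m : σ.points i₀ ∈ σ.closedInterior := σ.point_mem_closedInterior i₀
    refine vol_le_of_slab (W := W) hrW (p := σ.points i₀) (fun x hx => ?_) hd0 (abs_nonneg _)
      hnW hn1 (fun x hx => ?_) (fun x hx => ?_)
    · rw [closedInterior_eq] at hx hi₀m
      exact sub_mem_of_mem_hull hx hi₀m
    · exact Metric.dist_le_diam_of_mem σ.isCompact_closedInterior.isBounded hx hi₀m
    · rw [closedInterior_eq] at hx
      obtain ⟨w, hw, rfl⟩ := mem_convexHull_image.1 hx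
      have : ∑ i, w i • σ.points i - σ.points i₀ = ∑ i, w i • (σ.points i - σ.points i₀) := by
        simp [smul_sub, Finset.sum_sub_distrib, ← Finset.sum_smul, hw.sum_eq]
      rw [this, hcomb, abs_mul, abs_of_nonneg (hw.nonneg j)]
      exact mul_le_of_le_one_left (abs_nonneg _) (hw.le_one j)
  have hheight : φ₀ / 2 ^ m * d ≤ h := by
    have hlm : l + 1 ≤ m := le_of_affineIndependent σ.independent
    have h1 : φ₀ * d ≤ 2 ^ (l + 1) * h := by
      refine le_of_mul_le_mul_right ?_ (pow_pos hdpos l)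
      calc φ₀ * d * d ^ l = φ₀ * d ^ (l + 1) := by ring
        _ ≤ (2 * h) * (2 * d) ^ l := hvol.trans hslab
        _ = 2 ^ (l + 1) * h * d ^ l := by ring
    have h2 : (2 : ℝ) ^ (l + 1) ≤ 2 ^ m := pow_le_pow_right₀ (by norm_num) hlm
    rw [div_mul_eq_mul_div, div_le_iff₀ (by positivity), mul_comm h]
    exact h1.trans (mul_le_mul_of_nonneg_right h2 (abs_nonneg _))
  have hsum : ∑ i, t i • σ.points i = ∑ i, t i • (σ.points i - σ.points i₀) := by
    simp [smul_sub, Finset.sum_sub_distrib, ← Finset.sum_smul, ht]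
  calc φ₀ / 2 ^ m * d * |t j| ≤ h * |t j| := mul_le_mul_of_nonneg_right hheight (abs_nonneg _)
    _ = |inner ℝ n (∑ i, t i • σ.points i)| := by rw [hsum, hcomb, abs_mul, mul_comm]
    _ ≤ ‖n‖ * ‖∑ i, t i • σ.points i‖ := abs_real_inner_le_norm _ _
    _ = _ := by rw [hn1, one_mul]

/-- A simplex with spread vertices contains a ball about its barycenter, hence has a large
volume. -/
theorem IsSpread.le_vol {ι : Type*} [Fintype ι] {s : ℝ} (hs : 0 < s) {P : ι → E m}
    (hP : IsSpread s P) {f : Finset ι} (hf : f.Nonempty) :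
    (s / f.card) ^ (f.card - 1) * ballVol (f.card - 1) ≤
      vol (f.card - 1) (convexHull ℝ (P '' f)) := by
  classical
  have hc : (0 : ℝ) < f.card := by exact_mod_cast hf.card_pos
  set w : ι → ℝ := fun i => if i ∈ f then (f.card : ℝ)⁻¹ else 0 with hw
  have hwt : IsWeight f w := by
    refine ⟨fun i => ?_, fun i hi => by simp [hw, hi], ?_⟩
    · simp only [hw]; split_ifs <;> positivity
    · simp [hw, hc.ne']
  have hp : ∑ i, w i • P i ∈ convexHull ℝ (P '' f) := mem_convexHull_image.2 ⟨w, hwt, rfl⟩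
  have hr := finrank_vectorSpan_image (hP.affineIndependent hs) hf
  refine FatSimplices.le_vol (W := vectorSpan ℝ (P '' f)) (by omega)
    (fun x hx => sub_mem_of_mem_hull hx hp) (isBounded_hull P f) (by positivity) ?_
  intro u hu hlt
  obtain ⟨t, ht0, hts, rfl⟩ := mem_vectorSpan_image.1 hu
  refine mem_convexHull_image.2 ⟨w + t, hwt.add ht0 hts fun i hi => ?_, by
    simp [add_smul, Finset.sum_add_distrib]⟩
  have h1 := (hP t hts i).trans hlt.le
  rw [div_eq_mul_inv] at h1
  have h2 := le_of_mul_le_mul_left h1 hs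
  simp only [hw, hi, if_true]
  exact (neg_le_abs _).trans h2

/-- A simplex whose vertices are `α * d`-spread and have mutual distances at most `d` is fat, and
its volume is comparable to `d ^ l`. -/
theorem IsSpread.isFat {l : ℕ} {α d κ : ℝ} (hα : 0 < α) (hα1 : α ≤ 1) (hd : 0 < d)
    (hlm : l ≤ m) (hκ : 0 < κ) (hκl : ∀ j ≤ m, κ ≤ ballVol j)
    {τ : Simplex ℝ (E m) l} (hτ : IsSpread (α * d) τ.points)
    (hdist : ∀ i j, dist (τ.points i) (τ.points j) ≤ d) :
    vol l τ.closedInterior / d ^ l ≤ ballVol l ∧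
      (α / (m + 1)) ^ m * κ ≤ vol l τ.closedInterior / d ^ l ∧
      IsFat ((α / (m + 1)) ^ m * κ) τ := by
  have hlow : ∀ f : Finset (Fin (l + 1)), f.Nonempty →
      (α / (m + 1)) ^ m * κ * d ^ (f.card - 1) ≤
        vol (f.card - 1) (convexHull ℝ (τ.points '' f)) := by
    intro f hf
    have hc : (0 : ℝ) < f.card := by exact_mod_cast hf.card_pos
    have hcard : f.card ≤ l + 1 := by simpa using f.card_le_univ
    have hcm : (f.card : ℝ) ≤ m + 1 := by exact_mod_cast hcard.trans (by omega)
    refine le_trans ?_ (hτ.le_vol (mul_pos hα hd) hf)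
    have h1 : (α / (m + 1)) ^ m ≤ (α / f.card) ^ (f.card - 1) := by
      have h0 : α / (m + 1) ≤ 1 := by
        rw [div_le_one (by positivity)]
        have : (0 : ℝ) ≤ m := m.cast_nonneg
        linarith
      calc (α / (m + 1)) ^ m ≤ (α / (m + 1)) ^ (f.card - 1) :=
            pow_le_pow_of_le_one (by positivity) h0 (by omega)
        _ ≤ _ := by gcongr
    calc (α / (m + 1)) ^ m * κ * d ^ (f.card - 1)
        ≤ (α / f.card) ^ (f.card - 1) * ballVol (f.card - 1) * d ^ (f.card - 1) := by
          have := hκl (f.card - 1) (by omega)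
          gcongr
      _ = _ := by rw [mul_div_right_comm, mul_pow]; ring
  have hdiam : ∀ f : Finset (Fin (l + 1)),
      Metric.diam (convexHull ℝ (τ.points '' f)) ≤ d := by
    intro f
    rw [convexHull_diam]
    refine Metric.diam_le_of_forall_dist_le hd.le ?_
    rintro _ ⟨i, _, rfl⟩ _ ⟨j, _, rfl⟩
    exact hdist i j
  refine ⟨?_, ?_, ?_⟩
  · rw [div_le_iff₀ (by positivity), mul_comm]
    have h0 : τ.points 0 ∈ τ.closedInterior := τ.point_mem_closedInterior 0
    have hr := finrank_vectorSpan_image τ.independent (f := Finset.univ) Finset.univ_nonempty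
    have hdi := hdiam Finset.univ
    have hb := isBounded_hull τ.points Finset.univ
    rw [closedInterior_eq] at h0 ⊢
    refine vol_le (W := vectorSpan ℝ (τ.points '' (Finset.univ : Finset (Fin (l + 1)))))
      (by simpa using hr) (fun x hx => sub_mem_of_mem_hull hx h0) hd.le fun x hx => ?_
    exact (Metric.dist_le_diam_of_mem hb hx h0).trans hdi
  · rw [le_div_iff₀ (by positivity)]
    have := hlow Finset.univ Finset.univ_nonempty
    rw [← closedInterior_eq] at this
    simpa using this
  · have : Nonempty {f : Finset (Fin (l + 1)) // f.Nonempty} :=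
      ⟨⟨Finset.univ, Finset.univ_nonempty⟩⟩
    refine le_ciInf ?_
    rintro ⟨f, hf⟩
    have hpos : 0 < Metric.diam (convexHull ℝ (τ.points '' f)) ^ (f.card - 1) := by
      rcases Nat.lt_or_ge 1 f.card with h | h
      · obtain ⟨i, hi, j, hj, hij⟩ := Finset.one_lt_card.1 h
        refine pow_pos (Metric.diam_pos ⟨τ.points i,
          subset_convexHull ℝ _ (Set.mem_image_of_mem _ hi), τ.points j,
          subset_convexHull ℝ _ (Set.mem_image_of_mem _ hj), fun h => ?_⟩
          (isBounded_hull _ f)) _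
        exact hij (τ.independent.injective h)
      · rw [show f.card - 1 = 0 by omega, pow_zero]
        exact one_pos
    rw [le_div_iff₀ hpos]
    refine le_trans ?_ (hlow f hf)
    exact mul_le_mul_of_nonneg_left (pow_le_pow_left₀ Metric.diam_nonneg (hdiam f) _)
      (by positivity)

end

section

/-! ### Vertices of the intersection of two simplices -/

open Filter Topology in
/-- A weight can be moved a little along an affine relation that points inwards. -/
theorem IsWeight.eventually_add_smul {ι : Type*} [Fintype ι] {f : Finset ι} {w t : ι → ℝ}
    (hw : IsWeight f w) (ht : ∀ i ∉ f, t i = 0) (hs : ∑ i, t i = 0)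
    (hpos : ∀ i, w i = 0 → 0 ≤ t i) :
    ∀ᶠ ε in 𝓝[>] (0 : ℝ), IsWeight f (w + ε • t) := by
  have h : ∀ᶠ ε in 𝓝[>] (0 : ℝ), ∀ i, 0 ≤ w i + ε * t i := by
    rw [eventually_all]
    intro i
    rcases (hw.nonneg i).eq_or_lt with h0 | h0
    · filter_upwards [self_mem_nhdsWithin] with ε hε
      rw [← h0, zero_add]
      exact mul_nonneg (le_of_lt hε) (hpos i h0.symm)
    · have hc : Tendsto (fun ε : ℝ => w i + ε * t i) (𝓝 0) (𝓝 (w i + 0 * t i)) :=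
        Continuous.tendsto (by fun_prop) 0
      rw [zero_mul, add_zero] at hc
      filter_upwards [(hc.eventually (lt_mem_nhds h0)).filter_mono nhdsWithin_le_nhds] with ε hε
      exact hε.le
  filter_upwards [h] with ε hε
  refine hw.add (fun i hi => by simp [ht i hi]) (by simp [← Finset.mul_sum, hs]) fun i _ => ?_
  have := hε i
  simp only [Pi.smul_apply, smul_eq_mul]
  linarith

variable {m : ℕ} {ι κ : Type*} [Fintype ι] [Fintype κ]

/-- Faces of two simplices in `ℝᵐ` whose dimensions add up to less than `m` have distance more
than `η`. -/
def IsSeparated (η : ℝ) (P : ι → E m) (Q : κ → E m) : Prop :=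
  ∀ (f : Finset ι) (g : Finset κ), f.Nonempty → g.Nonempty → f.card + g.card < m + 2 →
    ∀ x ∈ convexHull ℝ (P '' f), ∀ y ∈ convexHull ℝ (Q '' g), η < dist x y

omit [Fintype ι] [Fintype κ] in
theorem IsSeparated.symm {η : ℝ} {P : ι → E m} {Q : κ → E m} (h : IsSeparated η P Q) :
    IsSeparated η Q P := fun f g hf hg hc x hx y hy => by
  rw [dist_comm]
  exact h g f hg hf (by omega) y hy x hx

/-- The intersection of the faces with vertex sets `f` and `g` of two simplices. -/
def inter (P : ι → E m) (Q : κ → E m) (f : Finset ι) (g : Finset κ) : Set (E m) :=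
  convexHull ℝ (P '' f) ∩ convexHull ℝ (Q '' g)

omit [Fintype ι] [Fintype κ] in
theorem inter_comm (P : ι → E m) (Q : κ → E m) (f : Finset ι) (g : Finset κ) :
    inter P Q f g = inter Q P g f := Set.inter_comm _ _

omit [Fintype ι] [Fintype κ] in
theorem isCompact_inter (P : ι → E m) (Q : κ → E m) (f : Finset ι) (g : Finset κ) :
    IsCompact (inter P Q f g) :=
  ((f.finite_toSet.image P).isCompact_convexHull ℝ).inter
    ((g.finite_toSet.image Q).isCompact_convexHull ℝ)

omit [Fintype ι] [Fintype κ] in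
theorem convex_inter (P : ι → E m) (Q : κ → E m) (f : Finset ι) (g : Finset κ) :
    Convex ℝ (inter P Q f g) :=
  (convex_convexHull ℝ _).inter (convex_convexHull ℝ _)

variable {P : ι → E m} {Q : κ → E m} {f : Finset ι} {g : Finset κ} {x : E m}
  {w : ι → ℝ} {z : κ → ℝ} {η : ℝ}

/-- At an extreme point of the intersection, the directions of the carrying faces have trivial
intersection: otherwise the point could be moved both ways along a common direction. -/
theorem inf_eq_bot_of_extreme
    (hx : x ∈ (inter P Q f g).extremePoints ℝ)
    (hw : IsWeight f w) (hwx : ∑ i, w i • P i = x) (hz : IsWeight g z)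
    (hzx : ∑ j, z j • Q j = x) :
    vectorSpan ℝ (P '' support w) ⊓ vectorSpan ℝ (Q '' support z) = ⊥ := by
  rw [Submodule.eq_bot_iff]
  rintro u ⟨hu1, hu2⟩
  obtain ⟨t, ht0, hts, htu⟩ := mem_vectorSpan_image.1 hu1
  obtain ⟨r, hr0, hrs, hru⟩ := mem_vectorSpan_image.1 hu2
  have ht0' : ∀ i, w i = 0 → t i = 0 := fun i hi => ht0 i (by simpa using hi)
  have hr0' : ∀ i, z i = 0 → r i = 0 := fun i hi => hr0 i (by simpa using hi)
  have h1 := hw.eventually_add_smul (t := t) (fun i hi => ht0' i (hw.eq_zero i hi)) hts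
    fun i hi => (ht0' i hi).ge
  have h2 := hw.eventually_add_smul (t := -t) (fun i hi => by simp [ht0' i (hw.eq_zero i hi)])
    (by simp [hts]) fun i hi => by simp [ht0' i hi]
  have h3 := hz.eventually_add_smul (t := r) (fun i hi => hr0' i (hz.eq_zero i hi)) hrs
    fun i hi => (hr0' i hi).ge
  have h4 := hz.eventually_add_smul (t := -r) (fun i hi => by simp [hr0' i (hz.eq_zero i hi)])
    (by simp [hrs]) fun i hi => by simp [hr0' i hi]
  obtain ⟨ε, h1, h2, h3, h4, hε⟩ :=
    (h1.and (h2.and (h3.and (h4.and self_mem_nhdsWithin)))).exists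
  have hε : (0 : ℝ) < ε := hε
  have hplus : x + ε • u ∈ inter P Q f g :=
    ⟨mem_convexHull_image.2 ⟨_, h1, by
      simp [add_smul, Finset.sum_add_distrib, hwx, ← htu, Finset.smul_sum, mul_smul]⟩,
     mem_convexHull_image.2 ⟨_, h3, by
      simp [add_smul, Finset.sum_add_distrib, hzx, ← hru, Finset.smul_sum, mul_smul]⟩⟩
  have hminus : x - ε • u ∈ inter P Q f g :=
    ⟨mem_convexHull_image.2 ⟨_, h2, by
      simp [add_smul, Finset.sum_add_distrib, hwx, ← htu, Finset.smul_sum, mul_smul,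
        sub_eq_add_neg]⟩,
     mem_convexHull_image.2 ⟨_, h4, by
      simp [add_smul, Finset.sum_add_distrib, hzx, ← hru, Finset.smul_sum, mul_smul,
        sub_eq_add_neg]⟩⟩
  have hseg : x ∈ openSegment ℝ (x + ε • u) (x - ε • u) :=
    ⟨1 / 2, 1 / 2, by norm_num, by norm_num, by norm_num, by module⟩
  have := (mem_extremePoints.1 hx).2 _ hplus _ hminus hseg
  have h0 : ε • u = 0 := by simpa using this.1
  exact (smul_eq_zero.1 h0).resolve_left hε.ne'

/-- A vertex of the intersection is carried by faces of complementary dimensions whose directions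
together span the whole space. -/
theorem complementary_of_extreme (hP : AffineIndependent ℝ P) (hQ : AffineIndependent ℝ Q)
    (hη : 0 ≤ η) (hsep : IsSeparated η P Q)
    (hx : x ∈ (inter P Q f g).extremePoints ℝ)
    (hw : IsWeight f w) (hwx : ∑ i, w i • P i = x) (hz : IsWeight g z)
    (hzx : ∑ j, z j • Q j = x) :
    (support w).card + (support z).card = m + 2 ∧
      vectorSpan ℝ (P '' support w) ⊔ vectorSpan ℝ (Q '' support z) = ⊤ := by
  have hbot := inf_eq_bot_of_extreme hx hw hwx hz hzx
  have h1 := finrank_vectorSpan_image hP hw.to_support.nonempty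
  have h2 := finrank_vectorSpan_image hQ hz.to_support.nonempty
  have h3 := Submodule.finrank_sup_add_finrank_inf_eq
    (vectorSpan ℝ (P '' support w)) (vectorSpan ℝ (Q '' support z))
  rw [hbot, finrank_bot, add_zero] at h3
  have h4 := Submodule.finrank_le
    (vectorSpan ℝ (P '' support w) ⊔ vectorSpan ℝ (Q '' support z))
  have hE : Module.finrank ℝ (E m) = m := by simp
  rw [hE] at h4
  have h5 : ¬ (support w).card + (support z).card < m + 2 := fun hlt => by
    have := hsep _ _ hw.to_support.nonempty hz.to_support.nonempty hlt x
      (mem_convexHull_image.2 ⟨w, hw.to_support, hwx⟩) x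
      (mem_convexHull_image.2 ⟨z, hz.to_support, hzx⟩)
    rw [dist_self] at this
    exact absurd this (not_lt.2 hη)
  refine ⟨by omega, Submodule.eq_top_of_finrank_eq ?_⟩
  rw [hE]
  omega

/-- The directions of two intersecting faces span the whole space. -/
theorem sup_eq_top (hP : AffineIndependent ℝ P) (hQ : AffineIndependent ℝ Q)
    (hη : 0 ≤ η) (hsep : IsSeparated η P Q) (hne : (inter P Q f g).Nonempty) :
    vectorSpan ℝ (P '' f) ⊔ vectorSpan ℝ (Q '' g) = ⊤ := by
  obtain ⟨x, hx⟩ := (isCompact_inter P Q f g).extremePoints_nonempty hne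
  obtain ⟨w, hw, hwx⟩ := mem_convexHull_image.1 (extremePoints_subset hx).1
  obtain ⟨z, hz, hzx⟩ := mem_convexHull_image.1 (extremePoints_subset hx).2
  rw [eq_top_iff, ← (complementary_of_extreme hP hQ hη hsep hx hw hwx hz hzx).2]
  exact sup_le_sup (vectorSpan_mono ℝ (Set.image_mono (by exact_mod_cast hw.support_subset)))
    (vectorSpan_mono ℝ (Set.image_mono (by exact_mod_cast hz.support_subset)))

/-- The expected dimension of the intersection of two intersecting faces. -/
theorem finrank_inf (hP : AffineIndependent ℝ P) (hQ : AffineIndependent ℝ Q)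
    (hη : 0 ≤ η) (hsep : IsSeparated η P Q) (hne : (inter P Q f g).Nonempty) :
    Module.finrank ℝ ↥(vectorSpan ℝ (P '' f) ⊓ vectorSpan ℝ (Q '' g)) + m + 2 =
      f.card + g.card := by
  obtain ⟨x, hx1, hx2⟩ := hne
  obtain ⟨w, hw, -⟩ := mem_convexHull_image.1 hx1
  obtain ⟨z, hz, -⟩ := mem_convexHull_image.1 hx2
  have h1 := finrank_vectorSpan_image hP hw.nonempty
  have h2 := finrank_vectorSpan_image hQ hz.nonempty
  have h3 := Submodule.finrank_sup_add_finrank_inf_eq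
    (vectorSpan ℝ (P '' f)) (vectorSpan ℝ (Q '' g))
  rw [sup_eq_top hP hQ hη hsep ⟨x, hx1, hx2⟩, finrank_top] at h3
  have hE : Module.finrank ℝ (E m) = m := by simp
  omega

/-- For every vertex `i` of a face, some vertex of the intersection does not lie on the facet
opposite to `i`: from a vertex on that facet one can move inside the intersection towards `i`,
because the directions of the carrying faces span the whole space. -/
theorem exists_extreme_pos (hP : AffineIndependent ℝ P) (hQ : AffineIndependent ℝ Q)
    (hη : 0 ≤ η) (hsep : IsSeparated η P Q) (hne : (inter P Q f g).Nonempty) {i : ι}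
    (hi : i ∈ f) :
    ∃ x ∈ (inter P Q f g).extremePoints ℝ, ∃ w, IsWeight f w ∧ ∑ i, w i • P i = x ∧ w i ≠ 0 := by
  classical
  by_contra! hcon
  have hsub : inter P Q f g ⊆ convexHull ℝ (P '' (f.erase i : Finset ι)) := by
    rw [← closure_convexHull_extremePoints (isCompact_inter P Q f g) (convex_inter P Q f g)]
    refine closure_minimal (convexHull_min (fun x hx => ?_) (convex_convexHull ℝ _))
      (((f.erase i).finite_toSet.image P).isCompact_convexHull ℝ).isClosed
    obtain ⟨w, hw, hwx⟩ := mem_convexHull_image.1 (extremePoints_subset hx).1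
    have h0 := hcon x hx w hw hwx
    refine mem_convexHull_image.2 ⟨w, ⟨hw.nonneg, fun j hj => ?_, hw.sum_eq⟩, hwx⟩
    by_cases hji : j = i
    · rw [hji, h0]
    · exact hw.eq_zero j fun hjf => hj (Finset.mem_erase.2 ⟨hji, hjf⟩)
  obtain ⟨x, hx⟩ := (isCompact_inter P Q f g).extremePoints_nonempty hne
  obtain ⟨w, hw, hwx⟩ := mem_convexHull_image.1 (extremePoints_subset hx).1
  obtain ⟨z, hz, hzx⟩ := mem_convexHull_image.1 (extremePoints_subset hx).2
  have hwi := hcon x hx w hw hwx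
  have htop := (complementary_of_extreme hP hQ hη hsep hx hw hwx hz hzx).2
  obtain ⟨a, ha, b, hb, hab⟩ := Submodule.mem_sup.1
    (show P i - x ∈ vectorSpan ℝ (P '' support w) ⊔ vectorSpan ℝ (Q '' support z) by
      rw [htop]; trivial)
  obtain ⟨t, ht0, hts, rfl⟩ := mem_vectorSpan_image.1 ha
  obtain ⟨r, hr0, hrs, rfl⟩ := mem_vectorSpan_image.1 hb
  have ht0' : ∀ i, w i = 0 → t i = 0 := fun i hi => ht0 i (by simpa using hi)
  have hr0' : ∀ i, z i = 0 → r i = 0 := fun i hi => hr0 i (by simpa using hi)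
  have h1 := hw.eventually_add_smul (t := Pi.single i 1 - w - t)
    (fun j hj => by
      have hji : j ≠ i := fun h => hj (h ▸ hi)
      simp [hji, hw.eq_zero j hj, ht0' j (hw.eq_zero j hj)])
    (by simp [hw.sum_eq, hts])
    (fun j hj => by
      by_cases hji : j = i
      · subst hji; simp [hj, ht0' j hj]
      · simp [hji, hj, ht0' j hj])
  have h2 := hz.eventually_add_smul (t := r) (fun i hi => hr0' i (hz.eq_zero i hi)) hrs
    fun i hi => (hr0' i hi).ge
  obtain ⟨ε, h1, h2, hε⟩ := (h1.and (h2.and self_mem_nhdsWithin)).exists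
  have hε : (0 : ℝ) < ε := hε
  have hy2 : ∑ j, (z + ε • r) j • Q j = x + ε • ∑ j, r j • Q j := by
    simp [add_smul, Finset.sum_add_distrib, hzx, Finset.smul_sum, mul_smul]
  have hsing : ∑ j, (Pi.single i (1 : ℝ) : ι → ℝ) j • P j = P i := by
    rw [Finset.sum_eq_single i (fun j _ hj => by simp [hj]) (by simp)]
    simp
  have hy1 : ∑ j, (w + ε • (Pi.single i 1 - w - t) : ι → ℝ) j • P j = x + ε • ∑ j, r j • Q j := by
    have hb : ∑ j, r j • Q j = P i - x - ∑ j, t j • P j := by rw [← hab]; abel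
    rw [hb, ← hsing]
    simp only [Pi.add_apply, Pi.smul_apply, Pi.sub_apply, smul_eq_mul, add_smul, mul_smul,
      sub_smul, Finset.sum_add_distrib, ← Finset.smul_sum, Finset.sum_sub_distrib, hwx]
  have hy : x + ε • ∑ j, r j • Q j ∈ inter P Q f g :=
    ⟨mem_convexHull_image.2 ⟨_, h1, hy1⟩, mem_convexHull_image.2 ⟨_, h2, hy2⟩⟩
  obtain ⟨v, hv, hvy⟩ := mem_convexHull_image.1 (hsub hy)
  have := weights_unique hP h1.sum_eq hv.sum_eq (hy1.trans hvy.symm)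
  have h0 := congrFun this i
  rw [hv.eq_zero i (by simp)] at h0
  simp [hwi, ht0' i hwi] at h0
  exact hε.ne' h0

/-- Quantitative form of the complementarity at a vertex: dropping a vertex `i` of the carrying face
leaves too small a dimension, so that the opposite facet is far from the other simplex. -/
theorem lt_weight_mul_of_extreme (hP : AffineIndependent ℝ P) (hQ : AffineIndependent ℝ Q)
    (hη : 0 ≤ η) (hsep : IsSeparated η P Q)
    (hx : x ∈ (inter P Q f g).extremePoints ℝ)
    (hw : IsWeight f w) (hwx : ∑ i, w i • P i = x) {D : ℝ}
    (hD : ∀ i j, dist (P i) (P j) ≤ D) {i : ι} (hi : w i ≠ 0) :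
    w i = 1 ∨ η < w i * D := by
  classical
  refine or_iff_not_imp_left.2 fun hi1 => ?_
  obtain ⟨z, hz, hzx⟩ := mem_convexHull_image.1 (extremePoints_subset hx).2
  have hcard := (complementary_of_extreme hP hQ hη hsep hx hw hwx hz hzx).1
  have hlt : w i < 1 := lt_of_le_of_ne (hw.le_one i) hi1
  set v : ι → ℝ := fun j => if j = i then 0 else w j / (1 - w i) with hv
  have hvw : IsWeight ((support w).erase i) v := by
    refine ⟨fun j => ?_, fun j hj => ?_, ?_⟩
    · simp only [hv]
      split_ifs
      · exact le_rfl
      · exact div_nonneg (hw.nonneg j) (by linarith)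
    · by_cases hji : j = i
      · simp [hv, hji]
      · have : w j = 0 := by simpa [hji] using hj
        simp [hv, this]
    · have h1 : ∑ j, w j = w i + ∑ j ∈ Finset.univ.erase i, w j :=
        (Finset.add_sum_erase _ _ (Finset.mem_univ i)).symm
      have h2 : ∑ j, v j = v i + ∑ j ∈ Finset.univ.erase i, v j :=
        (Finset.add_sum_erase _ _ (Finset.mem_univ i)).symm
      have h3 : ∑ j ∈ Finset.univ.erase i, v j =
          (∑ j ∈ Finset.univ.erase i, w j) / (1 - w i) := by
        rw [Finset.sum_div]
        exact Finset.sum_congr rfl fun j hj => by simp [hv, Finset.ne_of_mem_erase hj]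
      rw [h2, h3, show v i = 0 by simp [hv], zero_add, div_eq_one_iff_eq (by linarith)]
      rw [hw.sum_eq] at h1
      linarith
  set y := ∑ j, v j • P j with hy
  have hyx : x - y = w i • (P i - y) := by
    have : x = w i • P i + (1 - w i) • y := by
      rw [← hwx, hy, Finset.smul_sum, ← Finset.add_sum_erase _ _ (Finset.mem_univ i),
        ← Finset.add_sum_erase _ (fun j => (1 - w i) • v j • P j) (Finset.mem_univ i)]
      simp only [hv, if_true, zero_smul, smul_zero, zero_add]
      congr 1
      refine Finset.sum_congr rfl fun j hj => ?_
      rw [if_neg (Finset.ne_of_mem_erase hj), smul_smul,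
        mul_div_cancel₀ _ (by linarith : (1 : ℝ) - w i ≠ 0)]
    rw [this]
    module
  have hyh := mem_convexHull_image.2 ⟨v, hvw, hy.symm⟩
  have hball : y ∈ Metric.closedBall (P i) D := by
    refine convexHull_min ?_ (convex_closedBall _ _) hyh
    rintro _ ⟨j, _, rfl⟩
    exact hD j i
  have hi' : i ∈ support w := by simpa using hi
  have := hsep _ _ hvw.nonempty hz.to_support.nonempty
    (by rw [Finset.card_erase_of_mem hi']; have := Finset.card_pos.2 ⟨i, hi'⟩; omega) y hyh x
    (mem_convexHull_image.2 ⟨z, hz.to_support, hzx⟩)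
  rw [dist_comm, dist_eq_norm, hyx, norm_smul, Real.norm_of_nonneg (hw.nonneg i)] at this
  refine this.trans_le (mul_le_mul_of_nonneg_left ?_ (hw.nonneg i))
  rwa [Metric.mem_closedBall, dist_comm, dist_eq_norm] at hball

end

section

/-! ### Centers of cells -/

variable {m : ℕ} {ι κ : Type*} [Fintype ι] [Fintype κ] {P : ι → E m} {Q : κ → E m}
  {f : Finset ι} {g : Finset κ}

theorem IsWeight.average {σ : Type*} [Fintype σ] {W : σ → ι → ℝ} {N : ℕ} (hN0 : (N : ℝ) ≠ 0)
    (hN : Fintype.card σ = N) (hW : ∀ s, IsWeight f (W s)) :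
    IsWeight f fun i => (N : ℝ)⁻¹ * ∑ s, W s i := by
  refine ⟨fun i => ?_, fun i hi => ?_, ?_⟩
  · exact mul_nonneg (by positivity) (Finset.sum_nonneg fun s _ => (hW s).nonneg i)
  · rw [Finset.sum_eq_zero fun s _ => (hW s).eq_zero i hi, mul_zero]
  · rw [← Finset.mul_sum, Finset.sum_comm, Finset.sum_congr rfl fun s _ => (hW s).sum_eq]
    simp only [Finset.sum_const, Finset.card_univ, nsmul_eq_mul, mul_one]
    rw [hN, inv_mul_cancel₀ hN0]

/-- Averaging points of a cell, one for each vertex `i` of either simplex at which the `i`-th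
coordinate is large, gives a point all of whose barycentric coordinates are large. -/
theorem exists_average (hne : (inter P Q f g).Nonempty) {e₁ e₂ : ℝ}
    (h₁ : ∀ i ∈ f, ∃ x ∈ inter P Q f g, ∃ w, IsWeight f w ∧ ∑ i, w i • P i = x ∧ e₁ ≤ w i)
    (h₂ : ∀ j ∈ g, ∃ x ∈ inter P Q f g, ∃ z, IsWeight g z ∧ ∑ j, z j • Q j = x ∧ e₂ ≤ z j) :
    ∃ w z, IsWeight f w ∧ IsWeight g z ∧ ∑ i, w i • P i = ∑ j, z j • Q j ∧
      (∀ i ∈ f, e₁ ≤ (Fintype.card ι + Fintype.card κ : ℕ) * w i) ∧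
      ∀ j ∈ g, e₂ ≤ (Fintype.card ι + Fintype.card κ : ℕ) * z j := by
  have key : ∀ s : ι ⊕ κ, ∃ wz : (ι → ℝ) × (κ → ℝ), IsWeight f wz.1 ∧ IsWeight g wz.2 ∧
      ∑ i, wz.1 i • P i = ∑ j, wz.2 j • Q j ∧ (∀ i ∈ f, s = Sum.inl i → e₁ ≤ wz.1 i) ∧
      ∀ j ∈ g, s = Sum.inr j → e₂ ≤ wz.2 j := by
    have hdef : ∃ wz : (ι → ℝ) × (κ → ℝ), IsWeight f wz.1 ∧ IsWeight g wz.2 ∧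
        ∑ i, wz.1 i • P i = ∑ j, wz.2 j • Q j := by
      obtain ⟨x, hx1, hx2⟩ := hne
      obtain ⟨w, hw, hwx⟩ := mem_convexHull_image.1 hx1
      obtain ⟨z, hz, hzx⟩ := mem_convexHull_image.1 hx2
      exact ⟨(w, z), hw, hz, hwx.trans hzx.symm⟩
    rintro (i | j)
    · by_cases hi : i ∈ f
      · obtain ⟨x, hx, w, hw, hwx, hle⟩ := h₁ i hi
        obtain ⟨z, hz, hzx⟩ := mem_convexHull_image.1 hx.2
        exact ⟨(w, z), hw, hz, hwx.trans hzx.symm, fun i' _ h => by cases h; exact hle,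
          fun j _ h => (by cases h)⟩
      · obtain ⟨wz, h, h', h''⟩ := hdef
        exact ⟨wz, h, h', h'', fun i' hi' h => by cases h; exact absurd hi' hi,
          fun j _ h => (by cases h)⟩
    · by_cases hj : j ∈ g
      · obtain ⟨x, hx, z, hz, hzx, hle⟩ := h₂ j hj
        obtain ⟨w, hw, hwx⟩ := mem_convexHull_image.1 hx.1
        exact ⟨(w, z), hw, hz, hwx.trans hzx.symm, fun i _ h => (by cases h),
          fun j' _ h => by cases h; exact hle⟩
      · obtain ⟨wz, h, h', h''⟩ := hdef
        exact ⟨wz, h, h', h'', fun i _ h => (by cases h),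
          fun j' hj' h => by cases h; exact absurd hj' hj⟩
  choose F hF₁ hF₂ hF hF₃ hF₄ using key
  set N : ℕ := Fintype.card ι + Fintype.card κ with hN
  have hcard : Fintype.card (ι ⊕ κ) = N := Fintype.card_sum
  have hN0 : (N : ℝ) ≠ 0 := by
    obtain ⟨x, hx1, -⟩ := hne
    obtain ⟨w, hw, -⟩ := mem_convexHull_image.1 hx1
    obtain ⟨i, -⟩ := hw.nonempty
    have : 0 < Fintype.card ι := Fintype.card_pos_iff.2 ⟨i⟩
    exact_mod_cast (by omega : N ≠ 0)
  refine ⟨fun i => (N : ℝ)⁻¹ * ∑ s, (F s).1 i, fun j => (N : ℝ)⁻¹ * ∑ s, (F s).2 j,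
    IsWeight.average hN0 hcard hF₁, IsWeight.average hN0 hcard hF₂, ?_, fun i hi => ?_,
    fun j hj => ?_⟩
  · simp only [mul_smul, ← Finset.smul_sum, Finset.sum_smul]
    rw [Finset.sum_comm, Finset.sum_congr rfl fun s _ => hF s, Finset.sum_comm]
  · rw [mul_inv_cancel_left₀ hN0]
    exact (hF₃ _ i hi rfl).trans
      (Finset.single_le_sum (f := fun s => (F s).1 i) (fun s _ => (hF₁ s).nonneg i)
        (Finset.mem_univ (Sum.inl i)))
  · rw [mul_inv_cancel_left₀ hN0]
    exact (hF₄ _ j hj rfl).trans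
      (Finset.single_le_sum (f := fun s => (F s).2 j) (fun s _ => (hF₂ s).nonneg j)
        (Finset.mem_univ (Sum.inr j)))

/-- Every cell contains the ball of radius comparable to `D`, relative to the intersection of the
affine hulls of the two faces, about one of its points. -/
theorem exists_center {D D₂ a δ : ℝ} (ha : 0 < a) (hδ : 0 < δ) (hD : 0 < D) (hD₂ : D ≤ D₂)
    (hP : IsSpread (a * D) P) (hQ : IsSpread (a * D₂) Q)
    (hPD : ∀ i j, dist (P i) (P j) ≤ D) (hQD : ∀ i j, dist (Q i) (Q j) ≤ D₂)
    (hsep : IsSeparated (δ * D) P Q) (hne : (inter P Q f g).Nonempty) :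
    ∃ p ∈ inter P Q f g, ∀ u ∈ vectorSpan ℝ (P '' f) ⊓ vectorSpan ℝ (Q '' g),
      (Fintype.card ι + Fintype.card κ : ℕ) * ‖u‖ ≤ a * min δ 1 * D → p + u ∈ inter P Q f g := by
  have hPi := hP.affineIndependent (mul_pos ha hD)
  have hQi := hQ.affineIndependent (mul_pos ha (hD.trans_le hD₂))
  have hη : 0 ≤ δ * D := (mul_pos hδ hD).le
  have hD₂0 : 0 < D₂ := hD.trans_le hD₂
  have h₁ : ∀ i ∈ f, ∃ x ∈ inter P Q f g, ∃ w, IsWeight f w ∧ ∑ i, w i • P i = x ∧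
      min δ 1 ≤ w i := by
    intro i hi
    obtain ⟨x, hx, w, hw, hwx, hwi⟩ := exists_extreme_pos hPi hQi hη hsep hne hi
    refine ⟨x, extremePoints_subset hx, w, hw, hwx, ?_⟩
    rcases lt_weight_mul_of_extreme hPi hQi hη hsep hx hw hwx hPD hwi with h | h
    · exact (min_le_right _ _).trans h.ge
    · exact (min_le_left _ _).trans (lt_of_mul_lt_mul_right h hD.le).le
  have h₂ : ∀ j ∈ g, ∃ x ∈ inter P Q f g, ∃ z, IsWeight g z ∧ ∑ j, z j • Q j = x ∧
      min δ 1 * D / D₂ ≤ z j := by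
    intro j hj
    rw [inter_comm] at hne ⊢
    obtain ⟨x, hx, z, hz, hzx, hzj⟩ := exists_extreme_pos hQi hPi hη hsep.symm hne hj
    refine ⟨x, extremePoints_subset hx, z, hz, hzx, ?_⟩
    rw [div_le_iff₀ hD₂0]
    rcases lt_weight_mul_of_extreme hQi hPi hη hsep.symm hx hz hzx hQD hzj with h | h
    · rw [h, one_mul]
      exact (mul_le_of_le_one_left hD.le (min_le_right _ _)).trans hD₂
    · exact (mul_le_mul_of_nonneg_right (min_le_left _ _) hD.le).trans h.le
  obtain ⟨w, z, hw, hz, hwz, hw', hz'⟩ := exists_average hne h₁ h₂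
  set N : ℕ := Fintype.card ι + Fintype.card κ
  refine ⟨∑ i, w i • P i, ⟨mem_convexHull_image.2 ⟨w, hw, rfl⟩,
    mem_convexHull_image.2 ⟨z, hz, hwz.symm⟩⟩, fun u hu hle => ?_⟩
  have hN0 : (0 : ℝ) < N := by
    obtain ⟨i, -⟩ := hw.nonempty
    have : 0 < Fintype.card ι := Fintype.card_pos_iff.2 ⟨i⟩
    exact_mod_cast (by omega : 0 < N)
  obtain ⟨t, ht0, hts, htu⟩ := mem_vectorSpan_image.1 hu.1
  obtain ⟨r, hr0, hrs, hru⟩ := mem_vectorSpan_image.1 hu.2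
  constructor
  · refine mem_convexHull_image.2 ⟨w + t, hw.add ht0 hts fun i hi => ?_, by
      simp [add_smul, Finset.sum_add_distrib, htu]⟩
    refine (neg_le_abs _).trans (le_of_mul_le_mul_left ?_ (mul_pos hN0 (mul_pos ha hD)))
    calc N * (a * D) * |t i| = N * (a * D * |t i|) := by ring
      _ ≤ N * ‖u‖ := by
        have := hP t hts i
        rw [htu] at this
        gcongr
      _ ≤ a * D * min δ 1 := by linarith
      _ ≤ a * D * (N * w i) := by
        have := hw' i hi
        gcongr
      _ = N * (a * D) * w i := by ring
  · refine mem_convexHull_image.2 ⟨z + r, hz.add hr0 hrs fun j hj => ?_, by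
      simp [add_smul, Finset.sum_add_distrib, hru, hwz]⟩
    refine (neg_le_abs _).trans (le_of_mul_le_mul_left ?_ (mul_pos hN0 (mul_pos ha hD₂0)))
    calc N * (a * D₂) * |r j| = N * (a * D₂ * |r j|) := by ring
      _ ≤ N * ‖u‖ := by
        have := hQ r hrs j
        rw [hru] at this
        gcongr
      _ ≤ a * min δ 1 * D := hle
      _ = a * D₂ * (min δ 1 * D / D₂) := by field_simp
      _ ≤ a * D₂ * (N * z j) := by
        have := hz' j hj
        gcongr
      _ = N * (a * D₂) * z j := by ring

/-- If a subset of an affine subspace with direction `W` contains a ball of the subspace, then `W`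
is its direction. -/
theorem vectorSpan_eq_of_ball {W : Submodule ℝ (E m)} {A : Set (E m)} {p : E m} {ρ : ℝ}
    (hρ : 0 < ρ) (hA : ∀ x ∈ A, x - p ∈ W) (hball : ∀ u ∈ W, ‖u‖ ≤ ρ → p + u ∈ A) :
    vectorSpan ℝ A = W := by
  have hp : p ∈ A := by simpa using hball 0 W.zero_mem (by simpa using hρ.le)
  refine le_antisymm ?_ fun u hu => ?_
  · rw [vectorSpan_eq_span_vsub_set_right ℝ hp, Submodule.span_le]
    rintro _ ⟨x, hx, rfl⟩
    exact hA x hx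
  · rcases eq_or_ne u 0 with rfl | hu0
    · exact Submodule.zero_mem _
    have hn : 0 < ‖u‖ := norm_pos_iff.2 hu0
    have h1 : p + (ρ / ‖u‖) • u ∈ A := hball _ (W.smul_mem _ hu) (by
      rw [norm_smul, norm_div, norm_norm, Real.norm_of_nonneg hρ.le, div_mul_cancel₀ _ hn.ne'])
    have h2 : (ρ / ‖u‖) • u ∈ vectorSpan ℝ A := by
      have := vsub_mem_vectorSpan ℝ h1 hp
      simpa using this
    exact (Submodule.smul_mem_iff _ (div_pos hρ hn).ne').1 h2

/-- A ball that is contained in the set, relative to its affine hull, stays off the relative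
boundary. -/
theorem le_infEDist_intrinsicFrontier {A : Set (E m)} {p : E m} {ρ : ℝ} (hp : p ∈ A)
    (hball : ∀ u ∈ vectorSpan ℝ A, ‖u‖ ≤ ρ → p + u ∈ A) :
    ENNReal.ofReal ρ ≤ Metric.infEDist p (intrinsicFrontier ℝ A) := by
  refine Metric.le_infEDist.2 fun z hz => ?_
  obtain ⟨y, hy, rfl⟩ := mem_intrinsicFrontier.1 hz
  by_contra! hlt
  rw [edist_dist, ENNReal.ofReal_lt_ofReal_iff_of_nonneg dist_nonneg] at hlt
  refine hy.2 (mem_interior_iff_mem_nhds.2 ?_)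
  have hopen : IsOpen {v : affineSpan ℝ A | dist p v < ρ} :=
    isOpen_lt (by fun_prop) continuous_const
  refine Filter.mem_of_superset (hopen.mem_nhds hlt) fun v hv => ?_
  have hv' : dist p (v : E m) < ρ := hv
  have h1 : (v : E m) - p ∈ vectorSpan ℝ A := by
    rw [← direction_affineSpan]
    exact AffineSubspace.vsub_mem_direction v.2 (mem_affineSpan ℝ hp)
  have := hball _ h1 (by rw [← dist_eq_norm, dist_comm]; exact hv'.le)
  simpa using this

theorem inter_frontier_nonempty {X : Type*} [TopologicalSpace X] {t u : Set X}
    (ht : IsPreconnected t) (h₁ : (t ∩ u).Nonempty) (h₂ : (t ∩ uᶜ).Nonempty) :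
    (t ∩ frontier u).Nonempty := by
  by_contra hcon
  rw [Set.not_nonempty_iff_eq_empty] at hcon
  have hout : ∀ x ∈ t, x ∈ closure u → x ∈ interior u := fun x hx hxc => by
    by_contra hxi
    exact (hcon ▸ (⟨hx, hxc, hxi⟩ : x ∈ t ∩ frontier u) : x ∈ (∅ : Set X))
  obtain ⟨x, hx, hxu⟩ := h₁
  obtain ⟨y, hy, hyu⟩ := h₂
  obtain ⟨v, -, hv1, hv2⟩ := ht (interior u) (closure u)ᶜ isOpen_interior
    isClosed_closure.isOpen_compl
    (fun v hv => (em (v ∈ closure u)).imp (hout v hv) id)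
    ⟨x, hx, hout x hx (subset_closure hxu)⟩
    ⟨y, hy, fun h => hyu (interior_subset (hout y hy h))⟩
  exact hv2 (subset_closure (interior_subset hv1))

/-- The ball about a deep point is contained in the cell: a segment leaving the cell would meet the
relative boundary. -/
theorem IsDeepPoint.add_mem {r : ℝ} {A : Set (E m)} {p u : E m}
    (h : IsDeepPoint r A p) (hu : u ∈ vectorSpan ℝ A) (hur : ‖u‖ ≤ r) : p + u ∈ A := by
  by_contra hcon
  have hmem : ∀ s : ℝ, p + s • u ∈ affineSpan ℝ A := fun s => by
    have h1 : s • u ∈ (affineSpan ℝ A).direction := by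
      rw [direction_affineSpan]; exact Submodule.smul_mem _ _ hu
    have := AffineSubspace.vadd_mem_of_mem_direction h1 (mem_affineSpan ℝ h.1)
    rwa [vadd_eq_add, add_comm] at this
  let γ : ℝ → affineSpan ℝ A := fun s => ⟨p + s • u, hmem s⟩
  have hγ : Continuous γ := Continuous.subtype_mk (by fun_prop) _
  have hpre : IsPreconnected (γ '' Set.Icc 0 1) := isPreconnected_Icc.image γ hγ.continuousOn
  obtain ⟨_, ⟨s, hs, rfl⟩, hfr⟩ := inter_frontier_nonempty hpre
    (u := ((↑) ⁻¹' A : Set (affineSpan ℝ A)))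
    ⟨γ 0, ⟨0, by simp, rfl⟩, by simpa [γ] using h.1⟩
    ⟨γ 1, ⟨1, by simp, rfl⟩, by simpa [γ] using hcon⟩
  have h1 : (γ s : E m) ∈ intrinsicFrontier ℝ A := mem_intrinsicFrontier.2 ⟨_, hfr, rfl⟩
  have h2 := h.2.trans_le (Metric.infEDist_le_edist_of_mem h1)
  rw [edist_dist] at h2
  have h3 := (ENNReal.ofReal_lt_ofReal_iff_of_nonneg ((norm_nonneg u).trans hur)).1 h2
  have h4 : dist p (γ s) = |s| * ‖u‖ := by simp [γ, norm_smul]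
  rw [h4, abs_of_nonneg hs.1] at h3
  nlinarith [hs.2, norm_nonneg u]

end

section

/-! ### Cells are polyhedral -/

variable {m : ℕ}

/-- The convex hull of affinely independent points is an intersection of finitely many half-spaces:
extend the points to an affine basis of the whole space and use its coordinates. -/
theorem exists_halfspaces {ι : Type*} {P : ι → E m} (hP : AffineIndependent ℝ P)
    (f : Finset ι) :
    ∃ H : Finset ((E m →L[ℝ] ℝ) × ℝ), convexHull ℝ (P '' f) = {x | ∀ h ∈ H, h.1 x ≤ h.2} := by
  classical
  have hs : AffineIndependent ℝ ((↑) : (P '' f : Set (E m)) → E m) :=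
    hP.range.mono (Set.image_subset_range _ _)
  obtain ⟨t, hst, hti, htop⟩ := exists_subset_affineIndependent_affineSpan_eq_top hs
  have : Fintype t := (finite_set_of_fin_dim_affineIndependent ℝ hti).fintype
  let b : AffineBasis t ℝ (E m) := ⟨(↑), hti, by simpa using htop⟩
  let f' : Finset t := Finset.univ.filter fun i => (i : E m) ∈ P '' f
  have hf' : ∀ i : t, i ∈ f' ↔ (i : E m) ∈ P '' f := fun i => by simp [f']
  have himg : P '' f = b '' f' := by
    ext x
    constructor
    · intro hx
      exact ⟨⟨x, hst hx⟩, (hf' _).2 hx, rfl⟩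
    · rintro ⟨i, hi, rfl⟩
      exact (hf' i).1 hi
  have hmem : ∀ x, x ∈ convexHull ℝ (P '' f) ↔ IsWeight f' fun i => b.coord i x := by
    intro x
    rw [himg, mem_convexHull_image]
    constructor
    · rintro ⟨w, hw, hwx⟩
      have : w = fun i => b.coord i x :=
        weights_unique b.ind hw.sum_eq (b.sum_coord_apply_eq_one x)
          (hwx.trans (b.linear_combination_coord_eq_self x).symm)
      rwa [← this]
    · exact fun h => ⟨_, h, b.linear_combination_coord_eq_self x⟩
  let L : t → E m →L[ℝ] ℝ := fun i => LinearMap.toContinuousLinearMap (b.coord i).linear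
  have hL : ∀ i x, b.coord i x = L i x + b.coord i 0 := fun i x =>
    congrFun (AffineMap.decomp (b.coord i)) x
  refine ⟨Finset.univ.image (fun i => (-L i, b.coord i 0)) ∪
    (Finset.univ.filter (· ∉ f')).image fun i => (L i, -b.coord i 0), ?_⟩
  ext x
  rw [hmem]
  constructor
  · intro hx h hh
    rcases Finset.mem_union.1 hh with hh | hh
    · obtain ⟨i, -, rfl⟩ := Finset.mem_image.1 hh
      have := hx.nonneg i
      rw [hL] at this
      simp only [neg_apply]
      linarith
    · obtain ⟨i, hi, rfl⟩ := Finset.mem_image.1 hh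
      have := hx.eq_zero i (Finset.mem_filter.1 hi).2
      rw [hL] at this
      simp only
      linarith
  · intro hx
    have hnn : ∀ i, 0 ≤ b.coord i x := fun i => by
      have := hx _ (Finset.mem_union_left _ (Finset.mem_image_of_mem _ (Finset.mem_univ i)))
      simp only [neg_apply] at this
      rw [hL]
      linarith
    refine ⟨hnn, fun i hi => le_antisymm ?_ (hnn i), b.sum_coord_apply_eq_one x⟩
    have := hx _ (Finset.mem_union_right _ (Finset.mem_image_of_mem _
      (Finset.mem_filter.2 ⟨Finset.mem_univ i, hi⟩)))
    simp only at this
    rw [hL]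
    linarith

theorem exists_halfspaces_inter {ι κ : Type*} {P : ι → E m} {Q : κ → E m}
    (hP : AffineIndependent ℝ P) (hQ : AffineIndependent ℝ Q) (f : Finset ι) (g : Finset κ) :
    ∃ H : Finset ((E m →L[ℝ] ℝ) × ℝ), inter P Q f g = {x | ∀ h ∈ H, h.1 x ≤ h.2} := by
  classical
  obtain ⟨H, hH⟩ := exists_halfspaces hP f
  obtain ⟨H', hH'⟩ := exists_halfspaces hQ g
  refine ⟨H ∪ H', ?_⟩
  rw [inter, hH, hH']
  ext x
  simp only [Set.mem_inter_iff, Set.mem_ofPred_eq, Finset.mem_union]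
  exact ⟨fun h k hk => hk.elim (h.1 k) (h.2 k),
    fun h => ⟨fun k hk => h k (Or.inl hk), fun k hk => h k (Or.inr hk)⟩⟩

/-! ### Simplices of the subdivision -/

theorem sum_smul_mem {ι : Type*} [Fintype ι] {A : AffineSubspace ℝ (E m)} {q : ι → E m} {w : ι → ℝ}
    (hw : ∑ i, w i = 1) (hq : ∀ i, q i ∈ A) : ∑ i, w i • q i ∈ A := by
  rw [← Finset.univ.affineCombination_eq_linear_combination _ _ hw]
  exact affineSpan_le.2 (Set.range_subset_iff.2 hq) (affineCombination_mem_affineSpan hw q)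

/-- If each point of a sequence has distance at least `α * D` from an affine subspace containing
its predecessors, then the points are spread. -/
theorem isSpread_of_le_dist {α D : ℝ} (hα : 0 < α) (hα1 : α ≤ 1) (hD : 0 < D) {n : ℕ}
    {q : Fin n → E m} (hdist : ∀ i j, dist (q i) (q j) ≤ D)
    (h : ∀ i, ∃ A : AffineSubspace ℝ (E m), (∀ j < i, q j ∈ A) ∧ ∀ z ∈ A, α * D ≤ dist (q i) z) :
    IsSpread ((α / 3) ^ n * D) q := by
  induction n with
  | zero => exact fun _ _ j => j.elim0
  | succ n ih =>
    intro t ht j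
    rcases n with _ | n
    · have : t j = 0 := by
        rw [← ht, Fintype.sum_eq_single j fun i hi =>
          absurd (Subsingleton.elim (α := Fin 1) i j) hi]
      simp [this]
    have hS := ih (q := fun i => q i.castSucc) (fun i j => hdist _ _) fun i => by
      obtain ⟨A, hA, hA'⟩ := h i.castSucc
      exact ⟨A, fun j hj => hA _ (Fin.castSucc_lt_castSucc_iff.2 hj), hA'⟩
    set S := (α / 3) ^ (n + 1) * D with hSdef
    have hS0 : 0 < S := by positivity
    have hSD : S ≤ D := mul_le_of_le_one_left hD.le
      (pow_le_one₀ (by positivity) (by linarith))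
    set ρ := ‖∑ i, t i • q i‖ with hρ
    set a := t (Fin.last (n + 1)) with ha
    have hsum : ∑ i : Fin (n + 1), t i.castSucc = -a := by
      rw [Fin.sum_univ_castSucc] at ht
      linarith
    have hlast : α * D * |a| ≤ ρ := by
      rcases eq_or_ne a 0 with h0 | h0
      · rw [h0, abs_zero, mul_zero]
        exact norm_nonneg _
      obtain ⟨A, hA, hA'⟩ := h (Fin.last (n + 1))
      have hz : ∑ i : Fin (n + 1), (-t i.castSucc / a) • q i.castSucc ∈ A := by
        refine sum_smul_mem ?_ fun i => hA _ (Fin.castSucc_lt_last i)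
        rw [← Finset.sum_div, Finset.sum_neg_distrib, hsum, neg_neg, div_self h0]
      have h1 := hA' _ hz
      have h2 : ∑ i, t i • q i = a • (q (Fin.last (n + 1)) -
          ∑ i : Fin (n + 1), (-t i.castSucc / a) • q i.castSucc) := by
        rw [Fin.sum_univ_castSucc, smul_sub, Finset.smul_sum]
        simp only [smul_smul, mul_div_cancel₀ _ h0, neg_smul, Finset.sum_neg_distrib]
        rw [sub_neg_eq_add, add_comm]
      rw [hρ, h2, norm_smul, Real.norm_eq_abs, ← dist_eq_norm, mul_comm]
      exact mul_le_mul_of_nonneg_left h1 (abs_nonneg _)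
    -- moving the last weight to the first vertex reduces to the points before the last one
    set t' : Fin (n + 1) → ℝ := fun i => t i.castSucc + if i = 0 then a else 0 with ht'
    have hsum' : ∑ i, t' i = 0 := by
      simp [ht', Finset.sum_add_distrib, hsum]
    have hcomb : ∑ i, t' i • q i.castSucc =
        ∑ i, t i • q i - a • (q (Fin.last (n + 1)) - q 0) := by
      rw [Fin.sum_univ_castSucc fun i => t i • q i]
      simp only [ht', add_smul, Finset.sum_add_distrib, ite_smul, zero_smul, Finset.sum_ite_eq',
        Finset.mem_univ, if_true, Fin.castSucc_zero, smul_sub]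
      abel
    have hnorm : ‖∑ i, t' i • q i.castSucc‖ ≤ ρ + |a| * D := by
      rw [hcomb]
      refine (norm_sub_le _ _).trans (add_le_add le_rfl ?_)
      rw [norm_smul, Real.norm_eq_abs, ← dist_eq_norm]
      exact mul_le_mul_of_nonneg_left (hdist _ _) (abs_nonneg _)
    have hpow : (α / 3) ^ (n + 1 + 1) * D = α / 3 * S := by rw [hSdef]; ring
    rw [hpow]
    have ha1 : α * S * |a| ≤ ρ := by
      refine le_trans ?_ hlast
      gcongr
    have hρ0 : 0 ≤ ρ := norm_nonneg _
    refine Fin.lastCases ?_ (fun i => ?_) j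
    · nlinarith [mul_nonneg (mul_nonneg hα.le hS0.le) (abs_nonneg a)]
    · have h1 := (hS t' hsum' i).trans hnorm
      have h2 : |t i.castSucc| ≤ |t' i| + |a| := by
        have : t i.castSucc = t' i - if i = 0 then a else 0 := by simp [ht']
        rw [this]
        refine (abs_sub _ _).trans (add_le_add le_rfl ?_)
        split_ifs <;> simp
      have h3 : α * (S * |t' i|) ≤ α * ρ + ρ := by
        calc α * (S * |t' i|) ≤ α * (ρ + |a| * D) := by gcongr
          _ = α * ρ + α * D * |a| := by ring
          _ ≤ _ := by linarith
      have h4 : α * ρ ≤ ρ := mul_le_of_le_one_left hρ0 hα1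
      have h5 : α * S * |t i.castSucc| ≤ α * S * (|t' i| + |a|) := by gcongr
      nlinarith

theorem mem_affineSpan_image {ι : Type*} [Fintype ι] {P : ι → E m} {f : Finset ι} {z : E m}
    (hz : z ∈ affineSpan ℝ (P '' f)) :
    ∃ w : ι → ℝ, (∀ i ∉ f, w i = 0) ∧ ∑ i, w i = 1 ∧ ∑ i, w i • P i = z := by
  classical
  obtain ⟨_, i₀, hi₀, rfl⟩ : (P '' (f : Set ι)).Nonempty :=
    (affineSpan_nonempty ℝ).1 ⟨z, hz⟩
  have h : z - P i₀ ∈ vectorSpan ℝ (P '' f) := by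
    rw [← direction_affineSpan]
    exact AffineSubspace.vsub_mem_direction hz (mem_affineSpan ℝ ⟨i₀, hi₀, rfl⟩)
  obtain ⟨t, h0, hs, ht⟩ := mem_vectorSpan_image.1 h
  refine ⟨t + Pi.single i₀ 1, fun i hi => ?_, by simp [Finset.sum_add_distrib, hs], ?_⟩
  · have : i ≠ i₀ := fun h => hi (h ▸ hi₀)
    simp [h0 i hi, this]
  · simp only [Pi.add_apply, add_smul, Finset.sum_add_distrib, ht]
    rw [Finset.sum_eq_single i₀ (fun j _ hj => by simp [hj]) (by simp)]
    simp

/-- A deep point of `A` is far from the affine hull of a subset lying on a face that does not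
contain `A`, because this affine hull cannot enter the ball about the deep point: a barycentric
coordinate that is nonnegative on the ball would change its sign there. -/
theorem IsDeepPoint.le_dist {ι : Type*} [Fintype ι] {P : ι → E m} (hP : AffineIndependent ℝ P)
    {f f' : Finset ι} {A A' : Set (E m)} (hA : A ⊆ convexHull ℝ (P '' f))
    (hA' : A' ⊆ convexHull ℝ (P '' f')) (hsub : A' ⊆ A) {y : E m} (hy : y ∈ A)
    (hy' : y ∉ convexHull ℝ (P '' f')) {r : ℝ} {p : E m} (hp : IsDeepPoint r A p) {z : E m}
    (hz : z ∈ affineSpan ℝ A') : r ≤ dist p z := by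
  by_contra! hlt
  rw [dist_comm, dist_eq_norm] at hlt
  obtain ⟨w, hw, hwy⟩ := mem_convexHull_image.1 (hA hy)
  obtain ⟨i, hi, hwi⟩ : ∃ i ∉ f', w i ≠ 0 := by
    by_contra! hcon
    exact hy' (mem_convexHull_image.2 ⟨w, ⟨hw.nonneg, hcon, hw.sum_eq⟩, hwy⟩)
  have hspan : affineSpan ℝ A' ≤ affineSpan ℝ (P '' f') := by
    rw [← affineSpan_convexHull (P '' (f' : Set ι))]
    exact affineSpan_mono ℝ hA'
  obtain ⟨v, hv0, hvs, hvz⟩ := mem_affineSpan_image (hspan hz)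
  have hzA := affineSpan_mono ℝ hsub hz
  set s := (r - ‖z - p‖) / (‖z - y‖ + 1) with hs
  have hs0 : 0 < s := div_pos (by linarith) (by positivity)
  have hle : ‖z - p + s • (z - y)‖ ≤ r := by
    have h1 : s * ‖z - y‖ ≤ r - ‖z - p‖ := by
      calc s * ‖z - y‖ ≤ s * (‖z - y‖ + 1) := by gcongr; linarith
        _ = _ := div_mul_cancel₀ _ (by positivity)
    refine (norm_add_le _ _).trans ?_
    rw [norm_smul, Real.norm_of_nonneg hs0.le]
    linarith
  have hmem : z - p + s • (z - y) ∈ vectorSpan ℝ A := by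
    rw [← direction_affineSpan]
    exact Submodule.add_mem _ (AffineSubspace.vsub_mem_direction hzA (mem_affineSpan ℝ hp.1))
      (Submodule.smul_mem _ _ (AffineSubspace.vsub_mem_direction hzA (mem_affineSpan ℝ hy)))
  obtain ⟨u, hu, huz⟩ := mem_convexHull_image.1 (hA (hp.add_mem hmem hle))
  have huniq := weights_unique hP (w := u) (z := v + s • (v - w)) hu.sum_eq
    (by simp [Finset.sum_add_distrib, ← Finset.mul_sum, hvs, hw.sum_eq]) (by
      rw [huz]
      simp only [Pi.add_apply, Pi.smul_apply, Pi.sub_apply, smul_eq_mul, add_smul, mul_smul,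
        sub_smul, Finset.sum_add_distrib, ← Finset.smul_sum, Finset.sum_sub_distrib, hvz, hwy]
      abel)
  have h0 := congrFun huniq i
  have h1 := hu.nonneg i
  simp only [Pi.add_apply, Pi.smul_apply, Pi.sub_apply, smul_eq_mul, hv0 i hi] at h0
  have h2 : 0 < w i := lt_of_le_of_ne (hw.nonneg i) hwi.symm
  nlinarith

/-- A point off a face whose nonzero barycentric coordinates are all at least `e` is far from the
affine hull of the face. -/
theorem IsSpread.le_dist {ι : Type*} [Fintype ι] {P : ι → E m} {s e : ℝ} (hs : 0 ≤ s)
    (hP : IsSpread s P)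
    {f' : Finset ι} {w : ι → ℝ} (hw : IsWeight Finset.univ w) (hwe : ∀ i, w i ≠ 0 → e ≤ w i)
    (hx : ∑ i, w i • P i ∉ convexHull ℝ (P '' f')) {z : E m} (hz : z ∈ affineSpan ℝ (P '' f')) :
    s * e ≤ dist (∑ i, w i • P i) z := by
  obtain ⟨i, hi, hwi⟩ : ∃ i ∉ f', w i ≠ 0 := by
    by_contra! hcon
    exact hx (mem_convexHull_image.2 ⟨w, ⟨hw.nonneg, hcon, hw.sum_eq⟩, rfl⟩)
  obtain ⟨v, hv0, hvs, rfl⟩ := mem_affineSpan_image hz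
  rw [dist_eq_norm]
  refine le_trans ?_ (hP.abs_sub_le hw.sum_eq hvs i)
  rw [hv0 i hi, sub_zero]
  exact mul_le_mul_of_nonneg_left ((hwe i hwi).trans (le_abs_self _)) hs

end

/-! ### Transverse fat simplices -/

variable {m k₁ k₂ : ℕ} {σ₁ : Simplex ℝ (E m) k₁} {σ₂ : Simplex ℝ (E m) k₂}

theorem IsTransverse.isSeparated {δ : ℝ} (h : IsTransverse δ σ₁ σ₂) :
    IsSeparated (δ * Metric.diam σ₁.closedInterior) σ₁.points σ₂.points := by
  intro f g hf hg hc x hx y hy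
  have hf' : f.card = (f.card - 1) + 1 := (Nat.succ_pred_eq_of_pos hf.card_pos).symm
  have hg' : g.card = (g.card - 1) + 1 := (Nat.succ_pred_eq_of_pos hg.card_pos).symm
  have h1 := h.lt_dist _ _ f g hf' hg' (by omega)
  rw [closedInterior_face_eq, closedInterior_face_eq] at h1
  have h2 := h1.trans_le ((iInf₂_le x hx).trans (Metric.infEDist_le_edist_of_mem hy))
  rw [edist_dist] at h2
  exact (ENNReal.ofReal_lt_ofReal_iff_of_nonneg
    (mul_nonneg h.pos.le Metric.diam_nonneg)).1 h2

theorem mem_cells_iff {β : Set (E m)} :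
    β ∈ cells σ₁ σ₂ ↔ β.Nonempty ∧ ∃ f g, β = inter σ₁.points σ₂.points f g := by
  constructor
  · rintro ⟨hne, k₃, k₄, f, g, hf, hg, rfl⟩
    exact ⟨hne, f, g, by rw [closedInterior_face_eq, closedInterior_face_eq, inter]⟩
  · rintro ⟨hne, f, g, rfl⟩
    obtain ⟨x, hx1, hx2⟩ := hne
    have hf : f.Nonempty := by
      simpa using (convexHull_nonempty_iff (𝕜 := ℝ)).1 ⟨x, hx1⟩
    have hg : g.Nonempty := by
      simpa using (convexHull_nonempty_iff (𝕜 := ℝ)).1 ⟨x, hx2⟩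
    refine ⟨⟨x, hx1, hx2⟩, f.card - 1, g.card - 1, f, g,
      (Nat.succ_pred_eq_of_pos hf.card_pos).symm, (Nat.succ_pred_eq_of_pos hg.card_pos).symm, ?_⟩
    rw [closedInterior_face_eq, closedInterior_face_eq, inter]

theorem subset_closedInterior_of_mem_cells {β : Set (E m)} (hβ : β ∈ cells σ₁ σ₂) :
    β ⊆ σ₁.closedInterior := by
  obtain ⟨-, f, g, rfl⟩ := mem_cells_iff.1 hβ
  rw [closedInterior_eq]
  exact Set.inter_subset_left.trans (convexHull_mono (Set.image_mono (by simp)))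

/-- The dimension, volume and center of a cell of two fat transverse simplices, for `σ₁` not a
point. -/
theorem cell_geometry {a δ D₂ ε c κ : ℝ} (ha : 0 < a) (hδ : 0 < δ)
    (hD : 0 < Metric.diam σ₁.closedInterior) (hD₂ : Metric.diam σ₁.closedInterior ≤ D₂)
    (hP : IsSpread (a * Metric.diam σ₁.closedInterior) σ₁.points)
    (hQ : IsSpread (a * D₂) σ₂.points) (hQD : ∀ i j, dist (σ₂.points i) (σ₂.points j) ≤ D₂)
    (hsep : IsSeparated (δ * Metric.diam σ₁.closedInterior) σ₁.points σ₂.points)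
    (hε : 0 < ε) (hεa : (2 * (m + 1)) * ε ≤ a * min δ 1) (hcε : c < ε)
    (hκ : ∀ j ≤ m, κ ≤ ballVol j) (hcκ : ∀ j ≤ m, c ≤ ε ^ j * κ)
    {f : Finset (Fin (k₁ + 1))} {g : Finset (Fin (k₂ + 1))} {k₃ k₄ : ℕ}
    (hf : f.card = k₃ + 1) (hg : g.card = k₄ + 1)
    (hne : (inter σ₁.points σ₂.points f g).Nonempty) :
    m ≤ k₃ + k₄ ∧ IsConvexCell (k₃ + k₄ - m) (inter σ₁.points σ₂.points f g) ∧
      c * Metric.diam σ₁.closedInterior ^ (k₃ + k₄ - m) ≤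
        vol (k₃ + k₄ - m) (inter σ₁.points σ₂.points f g) ∧
      ∃ x, IsDeepPoint (c * Metric.diam σ₁.closedInterior)
        (inter σ₁.points σ₂.points f g) x := by
  set D := Metric.diam σ₁.closedInterior with hDdef
  set γ := inter σ₁.points σ₂.points f g with hγ
  have hrank := finrank_inf σ₁.independent σ₂.independent (mul_pos hδ hD).le hsep hne
  set W := vectorSpan ℝ (σ₁.points '' f) ⊓ vectorSpan ℝ (σ₂.points '' g) with hW
  obtain ⟨p, hp, hpW⟩ := exists_center ha hδ hD hD₂ hP hQ (dist_points_le σ₁) hQD hsep hne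
  have hk₁ := le_of_affineIndependent σ₁.independent
  have hk₂ := le_of_affineIndependent σ₂.independent
  have hf' : f.card ≤ k₁ + 1 := by simpa using f.card_le_univ
  have hg' : g.card ≤ k₂ + 1 := by simpa using g.card_le_univ
  have hball : ∀ u ∈ W, ‖u‖ ≤ ε * D → p + u ∈ γ := by
    intro u hu hle
    refine hpW u hu ?_
    have hcard : ((Fintype.card (Fin (k₁ + 1)) + Fintype.card (Fin (k₂ + 1)) : ℕ) : ℝ) ≤
        2 * (m + 1) := by
      simp only [Fintype.card_fin]
      exact_mod_cast (by omega : k₁ + 1 + (k₂ + 1) ≤ 2 * (m + 1))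
    calc ((Fintype.card (Fin (k₁ + 1)) + Fintype.card (Fin (k₂ + 1)) : ℕ) : ℝ) * ‖u‖
        ≤ (2 * (m + 1)) * (ε * D) := by gcongr
      _ = (2 * (m + 1)) * ε * D := by ring
      _ ≤ _ := by gcongr
  have hsub : ∀ x ∈ γ, x - p ∈ W := fun x hx =>
    ⟨sub_mem_of_mem_hull hx.1 hp.1, sub_mem_of_mem_hull hx.2 hp.2⟩
  have hspan : vectorSpan ℝ γ = W := vectorSpan_eq_of_ball (mul_pos hε hD) hsub hball
  have hWr : Module.finrank ℝ W = k₃ + k₄ - m := by omega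
  have hbdd : Bornology.IsBounded γ := (isBounded_hull _ f).subset Set.inter_subset_left
  refine ⟨by omega, ⟨hne, hbdd, exists_halfspaces_inter σ₁.independent σ₂.independent f g, ?_⟩,
    ?_, p, hp, ?_⟩
  · rw [dim, hspan, hWr]
  · refine le_trans ?_ (le_vol hWr hsub hbdd (mul_pos hε hD) fun u hu hlt => hball u hu hlt.le)
    have hj : k₃ + k₄ - m ≤ m := by omega
    have h1 := hκ _ hj
    have h2 := hcκ _ hj
    calc c * D ^ (k₃ + k₄ - m) ≤ ε ^ (k₃ + k₄ - m) * κ * D ^ (k₃ + k₄ - m) := by gcongr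
      _ = (ε * D) ^ (k₃ + k₄ - m) * κ := by ring
      _ ≤ _ := by gcongr
  · refine lt_of_lt_of_le ?_ (le_infEDist_intrinsicFrontier hp (by rw [hspan]; exact hball))
    exact (ENNReal.ofReal_lt_ofReal_iff (mul_pos hε hD)).2 (mul_lt_mul_of_pos_right hcε hD)

/-- The vertices of a simplex of the barycentric subdivision are spread, for `σ₁` not a point. -/
theorem flag_isSpread {a δ D₂ c : ℝ} (ha : 0 < a) (hδ : 0 < δ)
    (hD : 0 < Metric.diam σ₁.closedInterior) (hD₂ : Metric.diam σ₁.closedInterior ≤ D₂)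
    (hP : IsSpread (a * Metric.diam σ₁.closedInterior) σ₁.points)
    (hQ : IsSpread (a * D₂) σ₂.points) (hQD : ∀ i j, dist (σ₂.points i) (σ₂.points j) ≤ D₂)
    (hsep : IsSeparated (δ * Metric.diam σ₁.closedInterior) σ₁.points σ₂.points)
    (hc : 0 < c) (hc1 : c ≤ 1) (hca : c ≤ a * min δ 1) {r : ℕ} {p : Set (E m) → E m}
    (hp : ∀ β ∈ cells σ₁ σ₂, r ≤ dim β →
      IsDeepPoint (c * Metric.diam σ₁.closedInterior) β (p β))
    {l : ℕ} {q : Fin (l + 1) → E m} (hq : IsBarycentricSimplex σ₁ σ₂ r p q) :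
    IsSpread ((c / 3) ^ (l + 1) * Metric.diam σ₁.closedInterior) q := by
  set D := Metric.diam σ₁.closedInterior with hDdef
  have hD₂0 : 0 < D₂ := hD.trans_le hD₂
  obtain ⟨β, hβ, hcell, hqβ⟩ := hq
  have hmem : ∀ i, q i ∈ β i := fun i => by
    rcases hqβ i with ⟨hr, h⟩ | h
    · rw [h]
      exact (hp _ (hcell i) hr).1
    · exact h.2.1
  refine isSpread_of_le_dist hc hc1 hD (fun i j => ?_) fun i => ?_
  · exact Metric.dist_le_diam_of_mem σ₁.isCompact_closedInterior.isBounded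
      (subset_closedInterior_of_mem_cells (hcell i) (hmem i))
      (subset_closedInterior_of_mem_cells (hcell j) (hmem j))
  · refine Fin.cases ⟨⊥, fun j hj => absurd hj (Fin.not_lt_zero j), fun z hz => hz.elim⟩
      (fun i => ?_) i
    refine ⟨affineSpan ℝ (β i.castSucc), fun j hj => ?_, fun z hz => ?_⟩
    · exact mem_affineSpan ℝ (hβ.monotone (Fin.le_castSucc_iff.2 hj) (hmem j))
    have hlt : β i.castSucc < β i.succ := hβ Fin.castSucc_lt_succ
    obtain ⟨-, f', g', hfg'⟩ := mem_cells_iff.1 (hcell i.castSucc)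
    obtain ⟨-, f, g, hfg⟩ := mem_cells_iff.1 (hcell i.succ)
    rcases hqβ i.succ with ⟨hr, hqi⟩ | ⟨-, -, hvert, hnot⟩
    · obtain ⟨y, hy, hy'⟩ := Set.exists_of_ssubset hlt
      have hdeep := hp _ (hcell i.succ) hr
      rw [← hqi] at hdeep
      have hcases : y ∉ convexHull ℝ (σ₁.points '' f') ∨ y ∉ convexHull ℝ (σ₂.points '' g') := by
        by_contra! hcon
        exact hy' (hfg' ▸ hcon)
      rcases hcases with h | h
      · exact hdeep.le_dist σ₁.independent (hfg.le.trans Set.inter_subset_left)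
          (hfg'.le.trans Set.inter_subset_left) hlt.le hy h hz
      · exact hdeep.le_dist σ₂.independent (hfg.le.trans Set.inter_subset_right)
          (hfg'.le.trans Set.inter_subset_right) hlt.le hy h hz
    · have hy' := hnot i.castSucc Fin.castSucc_lt_succ
      obtain ⟨-, f₀, g₀, h₀⟩ := mem_cells_iff.1 hvert
      have hx : q i.succ ∈ (inter σ₁.points σ₂.points f₀ g₀).extremePoints ℝ := by
        rw [← h₀]; simp
      obtain ⟨w, hw, hwx⟩ := mem_convexHull_image.1 (extremePoints_subset hx).1
      obtain ⟨v, hv, hvx⟩ := mem_convexHull_image.1 (extremePoints_subset hx).2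
      have hη : 0 ≤ δ * D := (mul_pos hδ hD).le
      have hcases : q i.succ ∉ convexHull ℝ (σ₁.points '' f') ∨
          q i.succ ∉ convexHull ℝ (σ₂.points '' g') := by
        by_contra! hcon
        exact hy' (hfg' ▸ hcon)
      have hspan₁ : affineSpan ℝ (β i.castSucc) ≤ affineSpan ℝ (σ₁.points '' f') := by
        rw [← affineSpan_convexHull (σ₁.points '' (f' : Set (Fin (k₁ + 1)))), hfg']
        exact affineSpan_mono ℝ Set.inter_subset_left
      have hspan₂ : affineSpan ℝ (β i.castSucc) ≤ affineSpan ℝ (σ₂.points '' g') := by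
        rw [← affineSpan_convexHull (σ₂.points '' (g' : Set (Fin (k₂ + 1)))), hfg']
        exact affineSpan_mono ℝ Set.inter_subset_right
      rcases hcases with h | h
      · rw [← hwx] at h ⊢
        refine le_trans ?_ (hP.le_dist (mul_pos ha hD).le (e := min δ 1)
          (hw.mono (Finset.subset_univ _)) (fun j hj => ?_) h (hspan₁ hz))
        · calc c * D ≤ a * min δ 1 * D := by gcongr
            _ = a * D * min δ 1 := by ring
        · rcases lt_weight_mul_of_extreme σ₁.independent σ₂.independent hη hsep hx hw hwx
            (dist_points_le σ₁) hj with h | h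
          · exact (min_le_right _ _).trans h.ge
          · exact (min_le_left _ _).trans (lt_of_mul_lt_mul_right h hD.le).le
      · rw [inter_comm] at hx
        rw [← hvx] at h ⊢
        refine le_trans ?_ (hQ.le_dist (mul_pos ha hD₂0).le (e := min δ 1 * D / D₂)
          (hv.mono (Finset.subset_univ _)) (fun j hj => ?_) h (hspan₂ hz))
        · calc c * D ≤ a * min δ 1 * D := by gcongr
            _ = a * D₂ * (min δ 1 * D / D₂) := by field_simp
        · rw [div_le_iff₀ hD₂0]
          rcases lt_weight_mul_of_extreme σ₂.independent σ₁.independent hη hsep.symm hx hv hvx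
            hQD hj with h | h
          · rw [h, one_mul]
            exact (mul_le_of_le_one_left hD.le (min_le_right _ _)).trans hD₂
          · exact (mul_le_mul_of_nonneg_right (min_le_left _ _) hD.le).trans h.le

theorem exists_le_ballVol (m : ℕ) : ∃ κ : ℝ, 0 < κ ∧ κ ≤ 1 ∧ ∀ j ≤ m, κ ≤ ballVol j := by
  induction m with
  | zero => exact ⟨min 1 (ballVol 0), lt_min one_pos (ballVol_pos 0), min_le_left _ _,
      fun j hj => by rw [Nat.le_zero.1 hj]; exact min_le_right _ _⟩
  | succ m ih =>
    obtain ⟨κ, h0, h1, h⟩ := ih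
    refine ⟨min κ (ballVol (m + 1)), lt_min h0 (ballVol_pos _), (min_le_left _ _).trans h1,
      fun j hj => ?_⟩
    rcases Nat.le_succ_iff.1 hj with hj | rfl
    · exact (min_le_left _ _).trans (h j hj)
    · exact min_le_right _ _

/-- A simplex of diameter zero is a point. -/
theorem eq_zero_of_diam_eq_zero (h : Metric.diam σ₁.closedInterior = 0) : k₁ = 0 := by
  by_contra hk
  have h1 := dist_points_le σ₁ 0 (Fin.last k₁)
  rw [h] at h1
  have h2 := σ₁.independent.injective (dist_le_zero.1 h1)
  exact hk (by simpa using (congrArg Fin.val h2).symm)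

end FatSimplices

end

theorem proposition3p2 :
    ∃ φ : ℕ → ℝ, ∀ (m : ℕ) (φ₀ δ : ℝ), 0 < φ₀ → 0 < δ →
    ∃ c : ℝ, 0 < c ∧ ∃ c' : ℝ, 0 < c' ∧
    ∀ (k₁ k₂ : ℕ) (σ₁ : Affine.Simplex ℝ (EuclideanSpace ℝ (Fin m)) k₁)
      (σ₂ : Affine.Simplex ℝ (EuclideanSpace ℝ (Fin m)) k₂) (d₁ : ℝ),
      IsFat φ₀ σ₁ → IsFat φ₀ σ₂ →
      d₁ = Metric.diam σ₁.closedInterior → d₁ ≤ Metric.diam σ₂.closedInterior →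
      IsTransverse δ σ₁ σ₂ →
      -- the cells and their volumes; deep points
      (∀ (k₃ k₄ : ℕ) (f₃ : Finset (Fin (k₁ + 1))) (f₄ : Finset (Fin (k₂ + 1)))
        (h₃ : f₃.card = k₃ + 1) (h₄ : f₄.card = k₄ + 1) (γ₀ : Set (EuclideanSpace ℝ (Fin m))),
        γ₀ = (σ₁.face h₃).closedInterior ∩ (σ₂.face h₄).closedInterior → γ₀.Nonempty →
        m ≤ k₃ + k₄ ∧ IsConvexCell (k₃ + k₄ - m) γ₀ ∧
        c * d₁ ^ (k₃ + k₄ - m) ≤ vol (k₃ + k₄ - m) γ₀ ∧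
        ∃ x, IsDeepPoint (c * d₁) γ₀ x) ∧
      -- the barycentric subdivision
      (∀ r : ℕ, r = 1 ∨ r = 2 →
        ∀ p : Set (EuclideanSpace ℝ (Fin m)) → EuclideanSpace ℝ (Fin m),
        (∀ β ∈ cells σ₁ σ₂, r ≤ dim β → IsDeepPoint (c * d₁) β (p β)) →
        ∀ (l : ℕ) (q : Fin (l + 1) → EuclideanSpace ℝ (Fin m)),
          IsBarycentricSimplex σ₁ σ₂ r p q →
          ∃ τ : Affine.Simplex ℝ (EuclideanSpace ℝ (Fin m)) l, τ.points = q ∧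
            vol l τ.closedInterior / d₁ ^ l ≤ φ l ∧
            c' ≤ vol l τ.closedInterior / d₁ ^ l ∧
            IsFat c' τ) := by
  refine ⟨ballVol, fun m φ₀ δ hφ hδ => ?_⟩
  obtain ⟨κ, hκ0, hκ1, hκ⟩ := exists_le_ballVol m
  -- `a` bounds the heights of the simplices, `ε` the size of a ball in a cell
  set a : ℝ := φ₀ / 2 ^ m with ha
  have ha0 : 0 < a := by positivity
  have hδ1 : 0 < min δ 1 := lt_min hδ one_pos
  set ε : ℝ := min (a * min δ 1 / (2 * (m + 1))) 1 with hε
  have hε0 : 0 < ε := lt_min (by positivity) one_pos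
  have hε1 : ε ≤ 1 := min_le_right _ _
  have hεa : (2 * (m + 1)) * ε ≤ a * min δ 1 := by
    have h : ε ≤ a * min δ 1 / (2 * (m + 1)) := min_le_left _ _
    rw [le_div_iff₀ (by positivity)] at h
    linarith
  have hεa' : ε ≤ a * min δ 1 := by
    refine le_trans ?_ hεa
    have : (0 : ℝ) ≤ m := m.cast_nonneg
    nlinarith
  set c : ℝ := ε ^ (m + 1) * κ / 2 with hcdef
  have hc0 : 0 < c := by positivity
  have hcκ : ∀ j ≤ m + 1, c ≤ ε ^ j * κ / 2 := fun j hj => by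
    have := pow_le_pow_of_le_one hε0.le hε1 hj
    rw [hcdef]
    gcongr
  have hcε : c < ε := by
    have h1 := hcκ 1 (by omega)
    have h2 : ε * κ ≤ ε := mul_le_of_le_one_right hε0.le hκ1
    rw [pow_one] at h1
    linarith
  have hc1 : c ≤ 1 := hcε.le.trans hε1
  have hcκ' : ∀ j ≤ m, c ≤ ε ^ j * κ := fun j hj => by
    have h1 := hcκ j (by omega)
    have : 0 < ε ^ j * κ := by positivity
    linarith
  set α : ℝ := (c / 3) ^ (m + 1) with hα
  have hα0 : 0 < α := by positivity
  have hα1 : α ≤ 1 := pow_le_one₀ (by positivity) (by linarith)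
  refine ⟨c, hc0, (α / (m + 1)) ^ m * κ, by positivity, ?_⟩
  rintro k₁ k₂ σ₁ σ₂ d₁ hfat₁ hfat₂ rfl hd htr
  have hP := hfat₁.isSpread hφ
  have hQ := hfat₂.isSpread hφ
  have hsep := htr.isSeparated
  rcases (Metric.diam_nonneg (s := σ₁.closedInterior)).eq_or_lt with h0 | hD
  · -- `σ₁` is a point, which is then the only cell
    rw [← h0] at hsep ⊢
    have hk := eq_zero_of_diam_eq_zero h0.symm
    subst hk
    have hsingle : ∀ β ∈ cells σ₁ σ₂, β = {σ₁.points 0} := fun β hβ => by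
      have h1 := subset_closedInterior_of_mem_cells hβ
      rw [Simplex.closedInterior_eq_singleton] at h1
      exact hβ.1.subset_singleton_iff.1 h1
    refine ⟨?_, ?_⟩
    · rintro k₃ k₄ f₃ f₄ h₃ h₄ γ₀ hγ hne
      have hγs := hsingle γ₀ ⟨hne, k₃, k₄, f₃, f₄, h₃, h₄, hγ⟩
      rw [closedInterior_face_eq, closedInterior_face_eq] at hγ
      have hcard₃ : f₃.card ≤ 0 + 1 := by simpa using f₃.card_le_univ
      have hcard₄ : f₄.card ≤ k₂ + 1 := by simpa using f₄.card_le_univ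
      have hk₂ := le_of_affineIndependent σ₂.independent
      have hm : m ≤ k₃ + k₄ := by
        by_contra hlt
        obtain ⟨x, hx⟩ := hne
        rw [hγ] at hx
        have := hsep f₃ f₄ (Finset.card_pos.1 (by omega)) (Finset.card_pos.1 (by omega))
          (by omega) x hx.1 x hx.2
        simp at this
      have hq : k₃ + k₄ - m = 0 := by omega
      rw [hq]
      refine ⟨hm, ⟨hne, ?_, ?_, ?_⟩, ?_, σ₁.points 0, ?_, ?_⟩
      · rw [hγs]; exact Bornology.isBounded_singleton
      · rw [hγ]
        exact exists_halfspaces_inter σ₁.independent σ₂.independent f₃ f₄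
      · rw [hγs, dim, vectorSpan_singleton, finrank_bot]
      · rw [hγs, vol_zero_singleton, pow_zero, mul_one]
        exact hc1
      · rw [hγs]; rfl
      · rw [hγs, intrinsicFrontier_singleton, Metric.infEDist_empty]
        exact ENNReal.ofReal_lt_top
    · intro r _ p _ l q hq
      obtain ⟨β, hβ, hcell, -⟩ := hq
      have hl : l = 0 := by
        have h1 : β 0 = β (Fin.last l) := (hsingle _ (hcell 0)).trans (hsingle _ (hcell _)).symm
        simpa using (congrArg Fin.val (hβ.injective h1)).symm
      subst hl
      have hspread : IsSpread (α * 1) q := fun t ht j => by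
        have : t j = 0 := by
          rw [← ht, Fintype.sum_eq_single j fun i hi =>
            absurd (Subsingleton.elim (α := Fin 1) i j) hi]
        simp [this]
      have := IsSpread.isFat (τ := ⟨q, hspread.affineIndependent (by positivity)⟩) hα0 hα1 one_pos
        (Nat.zero_le m) hκ0 hκ hspread fun i j => by
          rw [Subsingleton.elim (α := Fin 1) i j, dist_self]
          exact zero_le_one
      refine ⟨⟨q, hspread.affineIndependent (by positivity)⟩, rfl, ?_⟩
      simpa only [pow_zero] using this
  · refine ⟨?_, ?_⟩
    · rintro k₃ k₄ f₃ f₄ h₃ h₄ γ₀ rfl hne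
      rw [closedInterior_face_eq, closedInterior_face_eq] at hne ⊢
      exact cell_geometry ha0 hδ hD hd hP hQ (dist_points_le σ₂) hsep hε0 hεa hcε hκ hcκ'
        h₃ h₄ hne
    · intro r _ p hp l q hq
      have hspread := flag_isSpread ha0 hδ hD hd hP hQ (dist_points_le σ₂) hsep hc0 hc1
        (hcε.le.trans hεa') hp hq
      have hind := hspread.affineIndependent (mul_pos (by positivity) hD)
      have hlm := le_of_affineIndependent hind
      have hspread' : IsSpread (α * Metric.diam σ₁.closedInterior) q := fun t ht j => by
        refine le_trans ?_ (hspread t ht j)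
        have : α ≤ (c / 3) ^ (l + 1) :=
          pow_le_pow_of_le_one (by positivity) (by linarith) (by omega)
        gcongr
      refine ⟨⟨q, hind⟩, rfl, IsSpread.isFat hα0 hα1 hD hlm hκ0 hκ hspread' fun i j => ?_⟩
      obtain ⟨β, -, hcell, hqβ⟩ := hq
      have hmem : ∀ i, q i ∈ σ₁.closedInterior := fun i => by
        refine subset_closedInterior_of_mem_cells (hcell i) ?_
        rcases hqβ i with ⟨hr, h⟩ | h
        · rw [h]
          exact (hp _ (hcell i) hr).1
        · exact h.2.1
      exact Metric.dist_le_diam_of_mem σ₁.isCompact_closedInterior.isBounded (hmem i) (hmem j)
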